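/- **Setting.** Let $d\ge 2$, $\omega=e^{2\pi i/d}$, $Z=\sum_{i}\omega^i|i\rangle\langle i|$ and $X=\sum_i|i+1\rangle\langle i|$ (indices modulo $d$) on $\mathbb C^d$. Let $\boldsymbol\alpha=(\alpha_0,\dots,\alpha_{d-1})$ with $\alpha_i>0$ and $\sum_i\alpha_i^2=1$, and put $|\psi(\boldsymbol\alpha)\rangle=\sum_i\alpha_i|i\rangle_A|i\rangle_B\in\mathbb C^d\otimes\mathbb C^d$ and $\rho_B(\boldsymbol\alpha)=\mathrm{Tr}_A|\psi(\boldsymbol\alpha)\rangle\langle\psi(\boldsymbol\alpha)|$. All Hilbert spaces are finite-dimensional. A POVM $\{M_b\}$ is a finite family of positive semidefinite operators with $\sum_b M_b=\mathbb 1$; it is extremal if it is not a proper convex combination of other POVMs with the same outcome set. In the one-sided device-independent (1SDI) scenario trusted Alice holds $\mathbb C^d$, untrusted Bob holds $\mathcal H_B$ and the eavesdropper Eve holds $\mathcal H_E$, where the dimensions of $\mathcal H_B,\mathcal H_E$ are finite but arbitrary. They share a pure state $|\psi_{ABE}\rangle\in\mathbb C^d\otimes\mathcal H_B\otimes\mathcal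 H_E$. Bob has two $d$-outcome POVMs $\{N_{b|0}\}$, $\{N_{b|1}\}$, with generalised observables $B_{k|y}=\sum_b\omega^{kb}N_{b|y}$, and a third POVM $\{R_b\}$ with $d^2$ outcomes. Eve has a POVM $\{E_b\}$ with the same outcome set as $\{R_b\}$. The steering functional is $$I(\boldsymbol\alpha)=\sum_{k=1}^{d-1}\big\langle Z^k\otimes B_{k|0}+\gamma(\boldsymbol\alpha)X^k\otimes B_{k|1}+\delta_k(\boldsymbol\alpha)Z^k\big\rangle,$$ $$\gamma(\boldsymbol\alpha)=d\Big(\sum_{i\ne j}\frac{\alpha_i}{\alpha_j}\Big)^{-1},\qquad \delta_k(\boldsymbol\alpha)=-\frac{\gamma(\boldsymbol\alpha)}{d}\sum_{i\neq j}\frac{\alpha_i}{\alpha_j}\,\omega^{k(d-j)}.$$ The steering inequality is *maximally violated* if $I(\boldsymbol\alpha)$ attains the largest value that it takes over all such states and measurements of Bob. The *POVM-certification conditions* for a reference POVM $\{\mathcal I_b\}$ on $\mathbb C^d$ are $$\langle\psi_{ABE}|X^iZ^j\otimes R_b\otimes\mathbb 1_E|\psi_{ABE}\rangle=\langle\psi(\boldsymbol\alpha)|X^iZ^j\otimes\mathcal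 I_b|\psi(\boldsymbol\alpha)\rangle\qquad\text{for all } b \text{ and } i,j=0,\dots,d-1.$$ Eve's guessing probability is $$G=\sup\ \sum_b\langle\psi_{ABE}|\mathbb 1_A\otimes R_b\otimes E_b|\psi_{ABE}\rangle,$$ the supremum over all $\mathcal H_B,\mathcal H_E$, states and POVMs as above for which the steering inequality is maximally violated and the POVM-certification conditions hold. The number of certified random bits is $-\log_2 G$. **Theorem.** 1. Let $\{\mathcal I_b\}$ be an extremal POVM on $\mathbb C^d$ with $d^2$ outcomes such that $\mathrm{Tr}[\mathcal I_b\,\rho_B(\boldsymbol\alpha)]=1/d^2$ for all $b$. Then the supremum defining $G$ is over a non-empty bounded set, $G=1/d^2$, and hence $2\log_2 d$ bits of randomness are certified. 2. Let $U_{k,l}=X^kZ^l$ and let $|\nu\rangle\in\mathbb C^d$ be a unit vector with $\langle\nu|U_{k,l}^\dagger|\nu\rangle\neq0$ for all $k,l=0,\dots,d-1$. Then $\mathcal I_{k,l}=\frac1d U_{k,l}|\nu\rangle\langle\nu|U_{k,l}^\dagger$ is an extremal POVM with $d^2$ outcomes. For the maximally entangled state, that is $\alpha_i=1/\sqrt d$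 for all $i$, it satisfies $\mathrm{Tr}[\mathcal I_{k,l}\,\rho_B]=1/d^2$ for all $k,l$; consequently $G=1/d^2$, and $2\log_2 d$ bits of randomness are certified. 3. For every $d\ge2$ such a vector $|\nu\rangle$ exists. -/

import Mathlib

open scoped TensorProduct InnerProductSpace ComplexConjugate

noncomputable section

namespace Steering

/-- The `d`-dimensional Hilbert space `ℂ^d` with its computational basis. -/
abbrev Qudit (d : ℕ) : Type := EuclideanSpace ℂ (Fin d)

/-- The computational basis vector `|i⟩`. -/
def ket {d : ℕ} (i : Fin d) : Qudit d := EuclideanSpace.single i (1 : ℂ)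

/-- `ω = exp(2πi/d)`. -/
def omega (d : ℕ) : ℂ := Complex.exp (2 * Real.pi * Complex.I / d)

/-- The operator `|x⟩⟨y|`. -/
def ketbra {H : Type*} [NormedAddCommGroup H] [InnerProductSpace ℂ H] (x y : H) : H →ₗ[ℂ] H :=
  (InnerProductSpace.rankOne ℂ x y : H →L[ℂ] H).toLinearMap

/-- `Z_d = ∑ i, ω^i |i⟩⟨i|`. -/
def Z (d : ℕ) : Qudit d →ₗ[ℂ] Qudit d :=
  ∑ i : Fin d, omega d ^ (i : ℕ) • ketbra (ket i) (ket i)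

/-- `X_d = ∑ i, |i + 1 mod d⟩⟨i|`. -/
def X (d : ℕ) : Qudit d →ₗ[ℂ] Qudit d :=
  ∑ i : Fin d, ketbra (ket (finRotate d i)) (ket i)

/-- A POVM with outcome set `O` on the Hilbert space `H`: positive operators summing to `1`. -/
def IsPOVM {O H : Type*} [Fintype O] [NormedAddCommGroup H] [InnerProductSpace ℂ H]
    (M : O → H →ₗ[ℂ] H) : Prop :=
  (∀ b, (M b).IsPositive) ∧ ∑ b, M b = 1

/-- A POVM is extremal if it is not a proper convex combination of other POVMs with the same
outcome set. -/
def IsExtremalPOVM {O H : Type*} [Fintype O] [NormedAddCommGroup H] [InnerProductSpace ℂ H]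
    (M : O → H →ₗ[ℂ] H) : Prop :=
  M ∈ Set.extremePoints ℝ {N : O → H →ₗ[ℂ] H | IsPOVM N}

/-- The generalised observables of a `d`-outcome measurement: `∑ b, ω^(k b) M_b`. -/
def genObs {d : ℕ} {H : Type*} [NormedAddCommGroup H] [InnerProductSpace ℂ H]
    (M : Fin d → H →ₗ[ℂ] H) (k : ℕ) : H →ₗ[ℂ] H :=
  ∑ b : Fin d, omega d ^ (k * (b : ℕ)) • M b

/-- The expectation value `⟨ψ|T|ψ⟩`. -/
def expect {H : Type*} [NormedAddCommGroup H] [InnerProductSpace ℂ H]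
    (ψ : H) (T : H →ₗ[ℂ] H) : ℂ := ⟪ψ, T ψ⟫_ℂ

/-- The operator `S ⊗ T ⊗ V` on `ℋ_A ⊗ ℋ_B ⊗ ℋ_E` with `ℋ_A = ℂ^d`. -/
def tri {d : ℕ} {HB HE : Type*} [NormedAddCommGroup HB] [InnerProductSpace ℂ HB]
    [NormedAddCommGroup HE] [InnerProductSpace ℂ HE]
    (S : Qudit d →ₗ[ℂ] Qudit d) (T : HB →ₗ[ℂ] HB) (V : HE →ₗ[ℂ] HE) :
    (Qudit d ⊗[ℂ] (HB ⊗[ℂ] HE)) →ₗ[ℂ] (Qudit d ⊗[ℂ] (HB ⊗[ℂ] HE)) :=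
  TensorProduct.map S (TensorProduct.map T V)

/-- `∑_{i ≠ j} α_i / α_j`. -/
def ratioSum {d : ℕ} (α : Fin d → ℝ) : ℝ :=
  ∑ i : Fin d, ∑ j : Fin d, if i ≠ j then α i / α j else 0

/-- `γ(α) = d (∑_{i ≠ j} α_i / α_j)⁻¹`. -/
def gammaCoeff {d : ℕ} (α : Fin d → ℝ) : ℝ := d * (ratioSum α)⁻¹

/-- `δ_k(α) = -(γ(α)/d) ∑_{i ≠ j} (α_i / α_j) ω^(k (d - j))`. -/
def deltaCoeff {d : ℕ} (α : Fin d → ℝ) (k : ℕ) : ℂ :=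
  -((gammaCoeff α / d : ℝ) : ℂ) *
    ∑ i : Fin d, ∑ j : Fin d,
      if i ≠ j then ((α i / α j : ℝ) : ℂ) * omega d ^ (k * (d - (j : ℕ))) else 0

/-- A quantum realisation of the steering experiment: a pure state of Alice, Bob and an external
system `E` (purifying the state of Alice and Bob), together with Bob's two `d`-outcome
measurements. -/
structure Realization (d : ℕ) (HB HE : Type*)
    [NormedAddCommGroup HB] [InnerProductSpace ℂ HB]
    [NormedAddCommGroup HE] [InnerProductSpace ℂ HE] where
  /-- the shared state `|ψ_ABE⟩` -/
  ψ : Qudit d ⊗[ℂ] (HB ⊗[ℂ] HE)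
  norm_ψ : ‖ψ‖ = 1
  /-- Bob's measurement for the input `0` -/
  B₀ : Fin d → HB →ₗ[ℂ] HB
  /-- Bob's measurement for the input `1` -/
  B₁ : Fin d → HB →ₗ[ℂ] HB
  povm_B₀ : IsPOVM B₀
  povm_B₁ : IsPOVM B₁

/-- The value of the steering functional
`∑_{k=1}^{d-1} ⟨A₀^k ⊗ B_{k|0} + γ(α) A₁^k ⊗ B_{k|1} + δ_k(α) A₀^k⟩`, `A₀ = Z_d`, `A₁ = X_d`.
The sum is a real number. -/
def Realization.value {d : ℕ} {HB HE : Type*}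
    [NormedAddCommGroup HB] [InnerProductSpace ℂ HB]
    [NormedAddCommGroup HE] [InnerProductSpace ℂ HE]
    (r : Realization d HB HE) (α : Fin d → ℝ) : ℝ :=
  (∑ k ∈ Finset.Ico 1 d,
    (expect r.ψ (tri (Z d ^ k) (genObs r.B₀ k) 1)
      + (gammaCoeff α : ℂ) * expect r.ψ (tri (X d ^ k) (genObs r.B₁ k) 1)
      + deltaCoeff α k * expect r.ψ (tri (Z d ^ k) 1 1))).re

/-- All values of the steering functional that are attainable in quantum theory, with
finite-dimensional systems of arbitrary dimension. -/
def quantumValues {d : ℕ} (α : Fin d → ℝ) : Set ℝ :=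
  {v | ∃ (HB HE : Type) (_ : NormedAddCommGroup HB) (_ : InnerProductSpace ℂ HB)
      (_ : NormedAddCommGroup HE) (_ : InnerProductSpace ℂ HE)
      (_ : FiniteDimensional ℂ HB) (_ : FiniteDimensional ℂ HE)
      (r : Realization d HB HE), v = r.value α}

/-- The realisation violates the steering inequality maximally: the functional attains the largest
value possible in quantum theory. -/
def Realization.ViolatesMaximally {d : ℕ} {HB HE : Type*}
    [NormedAddCommGroup HB] [InnerProductSpace ℂ HB]
    [NormedAddCommGroup HE] [InnerProductSpace ℂ HE]
    (r : Realization d HB HE) (α : Fin d → ℝ) : Prop :=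
  IsGreatest (quantumValues α) (r.value α)

/-- The target state `|ψ(α)⟩ = ∑ i, α_i |i⟩|i⟩`. -/
def idealState {d : ℕ} (α : Fin d → ℝ) : Qudit d ⊗[ℂ] Qudit d :=
  ∑ i : Fin d, (α i : ℂ) • (ket i ⊗ₜ[ℂ] ket i)

/-- The partial inner product `(⟨i| ⊗ 1) ψ`. -/
def partialBra {d : ℕ} (i : Fin d) (ψ : Qudit d ⊗[ℂ] Qudit d) : Qudit d :=
  TensorProduct.lid ℂ (Qudit d) (TensorProduct.map (innerₛₗ ℂ (ket i)) LinearMap.id ψ)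

/-- The partial trace over `A` of `|ψ⟩⟨ψ|`: `∑ i, (⟨i| ⊗ 1)|ψ⟩⟨ψ|(|i⟩ ⊗ 1)`. -/
def reducedState {d : ℕ} (ψ : Qudit d ⊗[ℂ] Qudit d) : Qudit d →ₗ[ℂ] Qudit d :=
  ∑ i : Fin d, ketbra (partialBra i ψ) (partialBra i ψ)

/-- A strategy in the presence of the eavesdropper Eve, who holds the system `E`: a realisation of
the steering experiment, the POVM `R` that Bob's device performs for his third input, and a POVM of
Eve, whose outcome is her guess of Bob's outcome. -/
structure Strategy (d : ℕ) (O HB HE : Type*) [Fintype O]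
    [NormedAddCommGroup HB] [InnerProductSpace ℂ HB]
    [NormedAddCommGroup HE] [InnerProductSpace ℂ HE] extends Realization d HB HE where
  /-- Bob's POVM for his third input -/
  R : O → HB →ₗ[ℂ] HB
  /-- Eve's POVM -/
  E : O → HE →ₗ[ℂ] HE
  povm_R : IsPOVM R
  povm_E : IsPOVM E

namespace Strategy

variable {d : ℕ} {O HB HE : Type*} [Fintype O]
    [NormedAddCommGroup HB] [InnerProductSpace ℂ HB]
    [NormedAddCommGroup HE] [InnerProductSpace ℂ HE]

/-- The conditions for the certification of the POVM: the statistics of `R` together with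
`X^i Z^j` on Alice's side are those of the reference POVM `I` on the state `|ψ(α)⟩`. -/
def MatchesPOVM (s : Strategy d O HB HE) (α : Fin d → ℝ) (I : O → Qudit d →ₗ[ℂ] Qudit d) : Prop :=
  ∀ (b : O) (i j : Fin d),
    expect s.ψ (tri (X d ^ (i : ℕ) * Z d ^ (j : ℕ)) (s.R b) 1)
      = expect (idealState α) (TensorProduct.map (X d ^ (i : ℕ) * Z d ^ (j : ℕ)) (I b))

/-- The probability that Eve's outcome equals Bob's outcome, `∑ b, ⟨ψ|1 ⊗ R_b ⊗ E_b|ψ⟩`. -/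
def guess (s : Strategy d O HB HE) : ℝ :=
  (∑ b, expect s.ψ (tri 1 (s.R b) (s.E b))).re

end Strategy

/-- The guessing probabilities of all strategies that are compatible with the maximal violation of
the steering inequality and the POVM-certification conditions. -/
def guessValues {d : ℕ} {O : Type*} [Fintype O] (α : Fin d → ℝ)
    (I : O → Qudit d →ₗ[ℂ] Qudit d) : Set ℝ :=
  {g | ∃ (HB HE : Type) (_ : NormedAddCommGroup HB) (_ : InnerProductSpace ℂ HB)
      (_ : NormedAddCommGroup HE) (_ : InnerProductSpace ℂ HE)
      (_ : FiniteDimensional ℂ HB) (_ : FiniteDimensional ℂ HE)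
      (s : Strategy d O HB HE),
      s.ViolatesMaximally α ∧ s.MatchesPOVM α I ∧ g = s.guess}

/-- Eve's guessing probability `G`, the supremum over all compatible strategies. -/
def guessingProbability {d : ℕ} {O : Type*} [Fintype O] (α : Fin d → ℝ)
    (I : O → Qudit d →ₗ[ℂ] Qudit d) : ℝ :=
  sSup (guessValues α I)

/-- The number of certified random bits: the min-entropy `-log₂ G`. -/
def certifiedBits {d : ℕ} {O : Type*} [Fintype O] (α : Fin d → ℝ)
    (I : O → Qudit d →ₗ[ℂ] Qudit d) : ℝ :=
  -Real.logb 2 (guessingProbability α I)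

/-- The unitaries `U_{k,l} = X_d^k Z_d^l`. -/
def U {d : ℕ} (k l : Fin d) : Qudit d →ₗ[ℂ] Qudit d := X d ^ (k : ℕ) * Z d ^ (l : ℕ)

/-- The Weyl-covariant POVM `(1/d) U_{k,l} |ν⟩⟨ν| U_{k,l}†`. -/
def weylPOVM {d : ℕ} (ν : Qudit d) (b : Fin d × Fin d) : Qudit d →ₗ[ℂ] Qudit d :=
  (1 / d : ℂ) • (U b.1 b.2 ∘ₗ ketbra ν ν ∘ₗ LinearMap.adjoint (U b.1 b.2))

/-- `⟨ν|U_{k,l}†|ν⟩ ≠ 0` for all `k, l`, for a unit vector `ν`. -/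
def IsWeylFiducial {d : ℕ} (ν : Qudit d) : Prop :=
  ‖ν‖ = 1 ∧ ∀ k l : Fin d, expect ν (LinearMap.adjoint (U k l)) ≠ 0

/-- The Schmidt coefficients of the maximally entangled state `(1/√d) ∑ i, |i⟩|i⟩`. -/
def maxEntangled (d : ℕ) : Fin d → ℝ := fun _ => 1 / Real.sqrt d

end Steering

end

open scoped TensorProduct InnerProductSpace ComplexConjugate

noncomputable section

namespace Steering

/-! ### Characters of ℤ/d -/

section RootsOfUnity

variable {d : ℕ} [NeZero d]

/-! Write the shared state as ∑ |i⟩ ⊗ v_i, with v_i in the joint space of Bob and Eve (`component`).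
After the k = 0 term is added to the steering functional, orthogonality of characters turns it into
d minus two sums of positive quadratic forms (`steering_sum_of_squares`): the weight on v_i of the
outcomes b ≠ -i of Bob's first measurement, and, for each element of his second measurement, the
defect in a weighted Cauchy–Schwarz inequality. The ideal realisation attains d, so maximal
violation means that every such term vanishes. With ξ_i = v_i/α_i, this says that A_b ξ_i = 0 unless
b = -i, and that C_b ξ_i = ω^(bi) C_b ξ_0.

These relations decouple Eve. Let W send |i⟩ to ξ_i. Then W†(1 ⊗ V)W is a scalar for every operator
V of Eve (`inner_decoupled`); Bob's measurements need not be projective. The X^i Z^j span all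
operators, so the certification conditions give W†(R_b ⊗ 1)W = I_b. The positive operators M_{c,b} =
W†(R_b ⊗ E_c)W therefore satisfy ∑_c M_{c,b} = I_b and ∑_b M_{c,b} = q_c 1. They exhibit I as a
mixture of POVMs with weights q_c, and extremality forces M_{c,b} = q_c I_b
(`IsExtremalPOVM.eq_smul`). The guessing probability is then ∑_b q_b Tr[I_b ρ_B] = 1/d², the same
for every compatible strategy, so no optimisation remains.

A POVM with linearly independent rank-one elements is extremal. For the Weyl orbit, a Fourier
transform in both indices turns a linear relation into products of the transformed coefficients with
the numbers ⟨ν|U†|ν⟩, which are nonzero. A fiducial vector comes from a geometric sequence s^i with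
s^d = 2^d i, whose cyclic autocorrelations have a closed form. -/

lemma isPrimitiveRoot_omega : IsPrimitiveRoot (omega d) d :=
  Complex.isPrimitiveRoot_exp d (NeZero.ne d)

lemma omega_pow_self : omega d ^ d = 1 := isPrimitiveRoot_omega.pow_eq_one

lemma norm_omega : ‖omega d‖ = 1 :=
  isPrimitiveRoot_omega.norm'_eq_one (NeZero.ne d)

lemma omega_mul_conj : omega d * conj (omega d) = 1 := by
  rw [Complex.mul_conj, Complex.normSq_eq_norm_sq, norm_omega]; simp

lemma omega_pow_mul_conj_pow (n : ℕ) : omega d ^ n * conj (omega d) ^ n = 1 := by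
  rw [← mul_pow, omega_mul_conj, one_pow]

lemma conj_omega_pow_self : conj (omega d) ^ d = 1 := by
  rw [← map_pow, omega_pow_self, map_one]

lemma omega_pow_mod (n : ℕ) : omega d ^ (n % d) = omega d ^ n :=
  (pow_eq_pow_mod n omega_pow_self).symm

lemma omega_pow_add_val (i j : Fin d) :
    omega d ^ ((i + j : Fin d) : ℕ) = omega d ^ (i : ℕ) * omega d ^ (j : ℕ) := by
  rw [Fin.val_add, omega_pow_mod, pow_add]

lemma omega_pow_mul_add_val (l : ℕ) (i j : Fin d) :
    omega d ^ (l * (i + j : Fin d)) = omega d ^ (l * i) * omega d ^ (l * j) := by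
  rw [mul_comm, pow_mul, omega_pow_add_val, mul_pow, ← pow_mul, ← pow_mul, mul_comm l, mul_comm l]

lemma conj_omega_pow_neg_val (b : Fin d) :
    conj (omega d) ^ ((-b : Fin d) : ℕ) = omega d ^ (b : ℕ) := by
  have h := omega_pow_add_val (-b) b
  rw [neg_add_cancel] at h
  simp only [Fin.val_zero, pow_zero] at h
  calc _ = conj (omega d) ^ ((-b : Fin d) : ℕ) *
        (omega d ^ ((-b : Fin d) : ℕ) * omega d ^ (b : ℕ)) := by rw [← h, mul_one]
    _ = (omega d ^ ((-b : Fin d) : ℕ) * conj (omega d) ^ ((-b : Fin d) : ℕ)) *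
        omega d ^ (b : ℕ) := by ring
    _ = _ := by rw [omega_pow_mul_conj_pow, one_mul]

/-- Orthogonality of the characters of `ℤ/d`. -/
lemma sum_omega_pow_mul_conj_pow (i j : Fin d) :
    ∑ k : Fin d, omega d ^ ((k : ℕ) * i) * conj (omega d) ^ ((k : ℕ) * j)
      = if i = j then (d : ℂ) else 0 := by
  set z := omega d ^ (i : ℕ) * conj (omega d) ^ (j : ℕ) with hz
  have h1 : ∀ k : Fin d, omega d ^ ((k : ℕ) * i) * conj (omega d) ^ ((k : ℕ) * j)
      = z ^ (k : ℕ) := fun k => by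
    rw [hz, mul_pow, ← pow_mul, ← pow_mul, mul_comm (i : ℕ), mul_comm (j : ℕ)]
  simp only [h1]
  rw [Fin.sum_univ_eq_sum_range (fun k => z ^ k) d]
  split_ifs with h
  · have : z = 1 := by rw [hz, h, omega_pow_mul_conj_pow]
    simp [this]
  · have hz1 : z ≠ 1 := by
      intro h2
      apply h
      have : omega d ^ (i : ℕ) = omega d ^ (j : ℕ) := by
        calc _ = z * omega d ^ (j : ℕ) := by
              rw [hz, mul_assoc, mul_comm (_ ^ (j : ℕ)), omega_pow_mul_conj_pow, mul_one]
          _ = _ := by rw [h2, one_mul]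
      exact Fin.ext (isPrimitiveRoot_omega.pow_inj i.2 j.2 this)
    have hzd : z ^ d = 1 := by
      rw [hz, mul_pow, ← pow_mul, ← pow_mul, mul_comm, mul_comm (j : ℕ), mul_comm (i : ℕ),
        pow_mul, pow_mul, omega_pow_self, conj_omega_pow_self]
      simp
    have := geom_sum_mul z d
    rw [hzd, sub_self] at this
    exact (mul_eq_zero.1 this).resolve_right (sub_ne_zero.2 hz1)

end RootsOfUnity

/-! ### Action of the Weyl operators on the computational basis -/

section Qudit

variable {d : ℕ}

lemma inner_ket (i : Fin d) (x : Qudit d) : ⟪ket i, x⟫_ℂ = x i := by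
  simp [ket, EuclideanSpace.inner_single_left]

lemma ket_apply (i j : Fin d) : ket i j = if j = i then (1 : ℂ) else 0 := by
  simp [ket]

lemma sum_smul_ket (x : Qudit d) : ∑ i, x i • ket i = x := by
  ext j
  simp [ket_apply]

lemma ketbra_apply {H : Type*} [NormedAddCommGroup H] [InnerProductSpace ℂ H] (x y z : H) :
    ketbra x y z = ⟪y, z⟫_ℂ • x := rfl

lemma isPositive_ketbra {H : Type*} [NormedAddCommGroup H] [InnerProductSpace ℂ H]
    [FiniteDimensional ℂ H] (x : H) : (ketbra x x).IsPositive := by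
  have := FiniteDimensional.complete ℂ H
  exact (ContinuousLinearMap.isPositive_toLinearMap_iff _).2
    (InnerProductSpace.isPositive_rankOne_self x)

lemma Z_ket (i : Fin d) : Z d (ket i) = omega d ^ (i : ℕ) • ket i := by
  simp [Z, ketbra_apply, inner_ket, ket_apply]

lemma X_ket [NeZero d] (i : Fin d) : X d (ket i) = ket (i + 1) := by
  simp [X, ketbra_apply, inner_ket, ket_apply, finRotate_apply]

lemma Z_pow_ket (k : ℕ) (i : Fin d) : (Z d ^ k) (ket i) = omega d ^ (k * i) • ket i := by
  induction k with
  | zero => simp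
  | succ k ih =>
    rw [pow_succ', Module.End.mul_apply, ih, map_smul, Z_ket, smul_smul, ← pow_add]
    congr 2; ring

lemma X_pow_ket [NeZero d] (k i : Fin d) : (X d ^ (k : ℕ)) (ket i) = ket (i + k) := by
  have h : ∀ n : ℕ, (X d ^ n) (ket i) = ket (i + (Fin.ofNat d n)) := by
    intro n
    induction n with
    | zero => simp
    | succ n ih =>
      rw [pow_succ', Module.End.mul_apply, ih, X_ket]
      congr 1
      ext
      simp [Fin.val_add, add_assoc]
  rw [h]
  simp

lemma U_ket [NeZero d] (k l i : Fin d) : U k l (ket i) = omega d ^ ((l : ℕ) * i) • ket (i + k) := by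
  rw [U, Module.End.mul_apply, Z_pow_ket, map_smul, X_pow_ket]

lemma linearMap_ext_ket {M : Type*} [AddCommGroup M] [Module ℂ M] {S T : Qudit d →ₗ[ℂ] M}
    (h : ∀ i, S (ket i) = T (ket i)) : S = T := by
  ext x
  rw [← sum_smul_ket x]
  simp [h]

lemma ext_inner_ket {S T : Qudit d →ₗ[ℂ] Qudit d}
    (h : ∀ i j, ⟪ket i, S (ket j)⟫_ℂ = ⟪ket i, T (ket j)⟫_ℂ) : S = T := by
  refine linearMap_ext_ket fun j => ?_
  ext i
  simpa [inner_ket] using h i j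

end Qudit

/-! ### Components of a vector along Alice's basis -/

section Components

variable {d : ℕ} {K : Type*} [NormedAddCommGroup K] [InnerProductSpace ℂ K]

/-- The component `(⟨i| ⊗ 1) ψ` of a vector of `ℂ^d ⊗ K`. -/
def component (ψ : Qudit d ⊗[ℂ] K) (i : Fin d) : K :=
  TensorProduct.lid ℂ K (TensorProduct.map (innerₛₗ ℂ (ket i)) LinearMap.id ψ)

lemma component_tmul (x : Qudit d) (y : K) (i : Fin d) : component (x ⊗ₜ[ℂ] y) i = x i • y := by
  simp [component, inner_ket]

lemma component_sum_ket (v : Fin d → K) (i : Fin d) :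
    component (∑ j, ket j ⊗ₜ[ℂ] v j) i = v i := by
  have : component (∑ j, ket j ⊗ₜ[ℂ] v j) i = ∑ j, component (ket j ⊗ₜ[ℂ] v j) i := by
    simp only [component, map_sum]
  simp [this, component_tmul, ket_apply]

lemma sum_ket_component (ψ : Qudit d ⊗[ℂ] K) : ∑ i, ket i ⊗ₜ[ℂ] component ψ i = ψ := by
  induction ψ using TensorProduct.induction_on with
  | zero => simp [component]
  | tmul x y =>
    simp only [component_tmul, ← TensorProduct.smul_tmul, ← TensorProduct.sum_tmul, sum_smul_ket]
  | add x y hx hy =>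
    conv_rhs => rw [← hx, ← hy]
    simp only [component, map_add, TensorProduct.tmul_add, Finset.sum_add_distrib]

lemma expect_map (ψ : Qudit d ⊗[ℂ] K) (S : Qudit d →ₗ[ℂ] Qudit d) (T : K →ₗ[ℂ] K) :
    expect ψ (TensorProduct.map S T)
      = ∑ i, ∑ j, ⟪ket i, S (ket j)⟫_ℂ * ⟪component ψ i, T (component ψ j)⟫_ℂ := by
  conv_lhs => rw [← sum_ket_component ψ]
  simp only [expect, map_sum, TensorProduct.map_tmul, sum_inner, inner_sum,
    TensorProduct.inner_tmul]
  rw [Finset.sum_comm]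

lemma expect_one {H : Type*} [NormedAddCommGroup H] [InnerProductSpace ℂ H] (ψ : H) :
    expect ψ 1 = (‖ψ‖ : ℂ) ^ 2 := inner_self_eq_norm_sq_to_K ψ

lemma sum_norm_component_sq (ψ : Qudit d ⊗[ℂ] K) : ∑ i, ‖component ψ i‖ ^ 2 = ‖ψ‖ ^ 2 := by
  have h := expect_map ψ 1 1
  rw [TensorProduct.map_one, expect_one] at h
  simp only [Module.End.one_apply, inner_ket, ket_apply, ite_mul, one_mul, zero_mul,
    Finset.sum_ite_eq, Finset.mem_univ, if_true] at h
  have h2 : ∀ i, ⟪component ψ i, component ψ i⟫_ℂ = (‖component ψ i‖ : ℂ) ^ 2 :=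
    fun i => inner_self_eq_norm_sq_to_K _
  simp only [h2] at h
  exact_mod_cast h.symm

end Components

/-! ### Positive operators as sums of rank-one terms -/

section Positive

variable {H K : Type*} [NormedAddCommGroup H] [InnerProductSpace ℂ H]
  [NormedAddCommGroup K] [InnerProductSpace ℂ K]

lemma exists_eq_sum_ketbra [FiniteDimensional ℂ H] {T : H →ₗ[ℂ] H} (hT : T.IsPositive) :
    ∃ (n : ℕ) (u : Fin n → H), T = ∑ i, ketbra (u i) (u i) := by
  have hT' := (LinearMap.isPositive_toContinuousLinearMap_iff T).2 hT
  obtain ⟨n, u, h⟩ := ContinuousLinearMap.isPositive_iff_eq_sum_rankOne.1 hT'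
  refine ⟨n, u, ?_⟩
  have h2 := congrArg (fun f : H →L[ℂ] H => f.toLinearMap) h
  simpa [ketbra] using h2

lemma map_ketbra (x : H) (y : K) :
    TensorProduct.map (ketbra x x) (ketbra y y) = ketbra (x ⊗ₜ[ℂ] y) (x ⊗ₜ[ℂ] y) := by
  ext a b
  simp [ketbra_apply, TensorProduct.smul_tmul', TensorProduct.tmul_smul, smul_smul, mul_comm]

/-- Expanding both factors into rank-one projections leaves a sum of rank-one projections onto
product vectors. -/
lemma isPositive_map [FiniteDimensional ℂ H] [FiniteDimensional ℂ K] {S : H →ₗ[ℂ] H}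
    {T : K →ₗ[ℂ] K} (hS : S.IsPositive) (hT : T.IsPositive) :
    (TensorProduct.map S T).IsPositive := by
  obtain ⟨n, u, rfl⟩ := exists_eq_sum_ketbra hS
  obtain ⟨m, v, rfl⟩ := exists_eq_sum_ketbra hT
  have : TensorProduct.map (∑ i, ketbra (u i) (u i)) (∑ j, ketbra (v j) (v j))
      = ∑ i, ∑ j, ketbra (u i ⊗ₜ[ℂ] v j) (u i ⊗ₜ[ℂ] v j) := by
    simp only [← map_ketbra, ← TensorProduct.mapBilinear_apply, map_sum, LinearMap.sum_apply]
    rw [Finset.sum_comm]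
  rw [this]
  exact LinearMap.isPositive_sum _ fun i _ => LinearMap.isPositive_sum _ fun j _ =>
    isPositive_ketbra _

/-- A positive operator annihilates every vector on which its quadratic form vanishes. -/
lemma apply_eq_zero_of_inner_eq_zero [FiniteDimensional ℂ H] {T : H →ₗ[ℂ] H} (hT : T.IsPositive)
    {x : H} (hx : RCLike.re ⟪x, T x⟫_ℂ = 0) : T x = 0 := by
  obtain ⟨n, u, rfl⟩ := exists_eq_sum_ketbra hT
  have h1 : ∀ i, ⟪x, ketbra (u i) (u i) x⟫_ℂ = ((‖⟪u i, x⟫_ℂ‖ ^ 2 : ℝ) : ℂ) := fun i => by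
    rw [ketbra_apply, inner_smul_right, ← inner_conj_symm x, Complex.mul_conj,
      Complex.normSq_eq_norm_sq]
  simp only [LinearMap.sum_apply, inner_sum, h1] at hx
  rw [← Complex.ofReal_sum] at hx
  have hx' : ∑ i, ‖⟪u i, x⟫_ℂ‖ ^ 2 = 0 := hx
  rw [Finset.sum_eq_zero_iff_of_nonneg (fun _ _ => by positivity)] at hx'
  rw [LinearMap.sum_apply]
  refine Finset.sum_eq_zero fun i hi => ?_
  have h2 : ⟪u i, x⟫_ℂ = 0 := norm_eq_zero.1 (pow_eq_zero_iff two_ne_zero |>.1 (hx' i hi))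
  rw [ketbra_apply, h2, zero_smul]

end Positive

/-! ### Sum-of-squares form of the steering functional -/

section SumOfSquares

variable {d : ℕ} [NeZero d] {K : Type*} [NormedAddCommGroup K] [InnerProductSpace ℂ K]

omit [NeZero d] in
lemma expect_map_Z_pow (ψ : Qudit d ⊗[ℂ] K) (k : ℕ) (T : K →ₗ[ℂ] K) :
    expect ψ (TensorProduct.map (Z d ^ k) T)
      = ∑ i : Fin d, omega d ^ (k * i) * ⟪component ψ i, T (component ψ i)⟫_ℂ := by
  simp [expect_map, Z_pow_ket, inner_ket, ket_apply]

lemma expect_map_X_pow (ψ : Qudit d ⊗[ℂ] K) (k : Fin d) (T : K →ₗ[ℂ] K) :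
    expect ψ (TensorProduct.map (X d ^ (k : ℕ)) T)
      = ∑ j : Fin d, ⟪component ψ (j + k), T (component ψ j)⟫_ℂ := by
  rw [expect_map, Finset.sum_comm]
  simp [X_pow_ket, inner_ket, ket_apply]

omit [NeZero d] in
lemma genObs_zero {M : Fin d → K →ₗ[ℂ] K} (hM : IsPOVM M) : genObs M 0 = 1 := by
  simp [genObs, hM.2]

/-- The phase in the (i, b) term is ω^(k(i+b)), so the sum over all k keeps only b = -i. Hence -i is
the outcome that Bob should obtain when Alice finds i. -/
lemma sum_Z_genObs (v : Fin d → K) (A : Fin d → K →ₗ[ℂ] K) :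
    ∑ k : Fin d, ∑ i : Fin d, omega d ^ ((k : ℕ) * i) * ⟪v i, genObs A k (v i)⟫_ℂ
      = d * ∑ i, ⟪v i, A (-i) (v i)⟫_ℂ := by
  have h : ∀ k i b : Fin d, omega d ^ ((k : ℕ) * i) * (omega d ^ ((k : ℕ) * b) *
      ⟪v i, A b (v i)⟫_ℂ) = (omega d ^ ((k : ℕ) * i) *
        conj (omega d) ^ ((k : ℕ) * (-b : Fin d))) * ⟪v i, A b (v i)⟫_ℂ := fun k i b => by
    rw [← mul_assoc, mul_comm (k : ℕ) ((-b : Fin d) : ℕ), pow_mul (conj (omega d)),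
      conj_omega_pow_neg_val, ← pow_mul, mul_comm (b : ℕ)]
  simp only [genObs, LinearMap.sum_apply, LinearMap.smul_apply, inner_sum, inner_smul_right,
    Finset.mul_sum, h]
  rw [Finset.sum_comm]
  refine Finset.sum_congr rfl fun i _ => ?_
  rw [Finset.sum_comm]
  simp only [← Finset.sum_mul, sum_omega_pow_mul_conj_pow, ite_mul, zero_mul]
  rw [Finset.sum_eq_single (-i)]
  · simp
  · intro b _ hb
    rw [if_neg]
    rintro rfl
    simp at hb
  · simp

/-- The Fourier transform `∑ j, ω^(-bj) v_j`. -/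
def fourier (v : Fin d → K) (b : Fin d) : K := ∑ j : Fin d, conj (omega d) ^ ((b : ℕ) * j) • v j

omit [NeZero d] in
lemma sum_comm_three (f : Fin d → Fin d → Fin d → ℂ) :
    ∑ k, ∑ j, ∑ b, f k j b = ∑ b, ∑ j, ∑ k, f k j b :=
  calc _ = ∑ k, ∑ b, ∑ j, f k j b := Finset.sum_congr rfl fun _ _ => Finset.sum_comm
    _ = ∑ b, ∑ k, ∑ j, f k j b := Finset.sum_comm
    _ = _ := Finset.sum_congr rfl fun _ _ => Finset.sum_comm

/-- For fixed b, the index i = j + k runs over all of ℤ/d independently of j, and ω^(bk) = ω^(bi)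
ω^(-bj). The double sum is thus a complete quadratic form in the Fourier transform of v. -/
lemma sum_X_genObs (v : Fin d → K) (C : Fin d → K →ₗ[ℂ] K) :
    ∑ k : Fin d, ∑ j : Fin d, ⟪v (j + k), genObs C k (v j)⟫_ℂ
      = ∑ b, ⟪fourier v b, C b (fourier v b)⟫_ℂ := by
  simp only [genObs, fourier, LinearMap.sum_apply, LinearMap.smul_apply, inner_sum, sum_inner,
    inner_smul_right, inner_smul_left, map_sum, map_smul, map_pow, Complex.conj_conj]
  rw [sum_comm_three]
  refine Finset.sum_congr rfl fun b _ => Finset.sum_congr rfl fun j _ => ?_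
  rw [← Equiv.sum_comp (Equiv.addLeft j) fun i => omega d ^ ((b : ℕ) * i) * _, Finset.mul_sum]
  refine Finset.sum_congr rfl fun k _ => ?_
  simp only [Equiv.coe_addLeft]
  rw [omega_pow_mul_add_val, mul_comm (k : ℕ)]
  linear_combination (-omega d ^ ((b : ℕ) * k) * ⟪v (j + k), C b (v j)⟫_ℂ) *
    omega_pow_mul_conj_pow (d := d) ((b : ℕ) * j)

/-- `∑_{i ≠ l} α_i / α_l`. -/
def rowRatio (α : Fin d → ℝ) (l : Fin d) : ℝ := ∑ i, if i ≠ l then α i / α l else 0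

omit [NeZero d] in
lemma sum_rowRatio (α : Fin d → ℝ) : ∑ l, rowRatio α l = ratioSum α := Finset.sum_comm

lemma deltaCoeff_eq (α : Fin d → ℝ) (k : ℕ) :
    deltaCoeff α k
      = -((gammaCoeff α / d : ℝ) : ℂ) *
        ∑ j : Fin d, (rowRatio α j : ℂ) * conj (omega d) ^ (k * j) := by
  rw [deltaCoeff, Finset.sum_comm]
  congr 1
  refine Finset.sum_congr rfl fun j _ => ?_
  have h : omega d ^ (k * (d - (j : ℕ))) = conj (omega d) ^ (k * j) := by
    have h1 : omega d ^ (k * (d - (j : ℕ))) * omega d ^ (k * (j : ℕ)) = 1 := by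
      rw [← pow_add, ← mul_add, Nat.sub_add_cancel j.2.le, mul_comm, pow_mul, omega_pow_self,
        one_pow]
    calc _ = (omega d ^ (k * (d - (j : ℕ))) * omega d ^ (k * (j : ℕ))) *
          conj (omega d) ^ (k * j) := by rw [mul_assoc, omega_pow_mul_conj_pow, mul_one]
      _ = _ := by rw [h1, one_mul]
  rw [h, rowRatio, Complex.ofReal_sum, Finset.sum_mul]
  refine Finset.sum_congr rfl fun i _ => ?_
  split_ifs <;> simp

/-- The δ_k are Fourier coefficients of the row ratios, so together they act as a diagonal
observable of Alice. It supplies the diagonal side of the Cauchy–Schwarz inequality. -/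
lemma sum_delta (α : Fin d → ℝ) (q : Fin d → ℂ) :
    ∑ k : Fin d, deltaCoeff α k * ∑ l : Fin d, omega d ^ ((k : ℕ) * l) * q l
      = -(gammaCoeff α : ℂ) * ∑ l, (rowRatio α l : ℂ) * q l := by
  have h : ∀ k : Fin d, deltaCoeff α k * ∑ l : Fin d, omega d ^ ((k : ℕ) * l) * q l
      = ∑ l : Fin d, ∑ j : Fin d, (-((gammaCoeff α / d : ℝ) : ℂ) * (rowRatio α j : ℂ) * q l) *
        (omega d ^ ((k : ℕ) * l) * conj (omega d) ^ ((k : ℕ) * j)) := fun k => by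
    rw [deltaCoeff_eq, mul_assoc, Finset.sum_mul_sum, Finset.mul_sum, Finset.sum_comm]
    refine Finset.sum_congr rfl fun l _ => ?_
    rw [Finset.mul_sum]
    exact Finset.sum_congr rfl fun j _ => by ring
  simp only [h]
  rw [Finset.sum_comm, Finset.mul_sum]
  refine Finset.sum_congr rfl fun l _ => ?_
  rw [Finset.sum_comm]
  simp only [← Finset.mul_sum, sum_omega_pow_mul_conj_pow, mul_ite, mul_zero, Finset.sum_ite_eq,
    Finset.mem_univ, if_true]
  have : (d : ℂ) ≠ 0 := Nat.cast_ne_zero.2 (NeZero.ne d)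
  push_cast
  field_simp

variable {α : Fin d → ℝ}

omit [NeZero d] in
lemma rowRatio_add_one (hα : ∀ i, 0 < α i) (l : Fin d) :
    rowRatio α l + 1 = (∑ i, α i) / α l := by
  have h1 : α l / α l = 1 := div_self (hα l).ne'
  rw [rowRatio, Finset.sum_div, ← h1]
  rw [← Finset.sum_erase_add _ _ (Finset.mem_univ l),
    ← Finset.sum_erase_add (s := Finset.univ) (fun i => α i / α l) (Finset.mem_univ l)]
  simp only [ne_eq, not_true, if_false, add_zero]
  congr 1
  exact Finset.sum_congr rfl fun i hi => if_pos (Finset.ne_of_mem_erase hi)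

omit [NeZero d] in
lemma ratioSum_pos (hd : 2 ≤ d) (hα : ∀ i, 0 < α i) : 0 < ratioSum α := by
  have : Nontrivial (Fin d) := Fin.nontrivial_iff_two_le.2 hd
  obtain ⟨i, j, hij⟩ := exists_pair_ne (Fin d)
  have hnn : ∀ i j, 0 ≤ if i ≠ j then α i / α j else 0 := fun i j => by
    split_ifs
    · exact (div_pos (hα i) (hα j)).le
    · exact le_rfl
  refine Finset.sum_pos' (fun i _ => Finset.sum_nonneg fun j _ => hnn i j)
    ⟨i, Finset.mem_univ _, ?_⟩
  refine Finset.sum_pos' (fun j _ => hnn i j) ⟨j, Finset.mem_univ _, ?_⟩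
  rw [if_pos hij]
  exact div_pos (hα i) (hα j)

omit [NeZero d] in
lemma gammaCoeff_pos (hd : 2 ≤ d) (hα : ∀ i, 0 < α i) : 0 < gammaCoeff α :=
  mul_pos (by exact_mod_cast (by omega : 0 < d)) (inv_pos.2 (ratioSum_pos hd hα))

lemma deltaCoeff_zero (hd : 2 ≤ d) (hα : ∀ i, 0 < α i) : deltaCoeff α 0 = -1 := by
  rw [deltaCoeff_eq]
  simp only [zero_mul, pow_zero, mul_one]
  rw [← Complex.ofReal_sum, sum_rowRatio, neg_mul, ← Complex.ofReal_mul]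
  have h1 := (ratioSum_pos hd hα).ne'
  have h2 : (d : ℝ) ≠ 0 := by exact_mod_cast (by omega : d ≠ 0)
  have : gammaCoeff α / d * ratioSum α = 1 := by
    rw [gammaCoeff]; field_simp
  rw [this, Complex.ofReal_one]

omit [NeZero d] in
/-- The defect of the Cauchy–Schwarz inequality as a sum of squares. -/
lemma cauchySchwarz_defect (hα : ∀ i, 0 < α i) (u : Fin d → K) (T : K →ₗ[ℂ] K) :
    ∑ j, (((∑ i, α i) / α j : ℝ) : ℂ) * ⟪u j, T (u j)⟫_ℂ - ⟪∑ j, u j, T (∑ j, u j)⟫_ℂ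
      = (1 / 2) * ∑ i, ∑ j, ((α i * α j : ℝ) : ℂ) *
        ⟪((α i)⁻¹ : ℂ) • u i - ((α j)⁻¹ : ℂ) • u j,
          T (((α i)⁻¹ : ℂ) • u i - ((α j)⁻¹ : ℂ) • u j)⟫_ℂ := by
  have hne : ∀ i, (α i : ℂ) ≠ 0 := fun i => Complex.ofReal_ne_zero.2 (hα i).ne'
  -- Over ordered pairs, the diagonal terms and the cross terms each contribute twice, which the
  -- factor 1/2 compensates.
  have h : ∀ i j, ((α i * α j : ℝ) : ℂ) *
        ⟪((α i)⁻¹ : ℂ) • u i - ((α j)⁻¹ : ℂ) • u j,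
          T (((α i)⁻¹ : ℂ) • u i - ((α j)⁻¹ : ℂ) • u j)⟫_ℂ
      = ((α j / α i : ℝ) : ℂ) * ⟪u i, T (u i)⟫_ℂ + ((α i / α j : ℝ) : ℂ) * ⟪u j, T (u j)⟫_ℂ
        - ⟪u i, T (u j)⟫_ℂ - ⟪u j, T (u i)⟫_ℂ := fun i j => by
    have hi := hne i
    have hj := hne j
    simp only [map_sub, map_smul, inner_sub_left, inner_sub_right, inner_smul_left,
      inner_smul_right, map_inv₀, Complex.conj_ofReal]
    push_cast
    field_simp
    ring
  simp only [h, Finset.sum_add_distrib, Finset.sum_sub_distrib]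
  have e1 : ∑ i, ∑ j, ((α j / α i : ℝ) : ℂ) * ⟪u i, T (u i)⟫_ℂ
      = ∑ j, (((∑ i, α i) / α j : ℝ) : ℂ) * ⟪u j, T (u j)⟫_ℂ := by
    refine Finset.sum_congr rfl fun i _ => ?_
    rw [← Finset.sum_mul, ← Complex.ofReal_sum, Finset.sum_div]
  have e2 : ∑ i, ∑ j, ((α i / α j : ℝ) : ℂ) * ⟪u j, T (u j)⟫_ℂ
      = ∑ j, (((∑ i, α i) / α j : ℝ) : ℂ) * ⟪u j, T (u j)⟫_ℂ := by
    rw [Finset.sum_comm]; exact e1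
  have e3 : ∑ i, ∑ j, ⟪u i, T (u j)⟫_ℂ = ⟪∑ j, u j, T (∑ j, u j)⟫_ℂ := by
    rw [map_sum, sum_inner]; simp only [inner_sum]
  have e4 : ∑ i, ∑ j, ⟪u j, T (u i)⟫_ℂ = ⟪∑ j, u j, T (∑ j, u j)⟫_ℂ := by
    rw [Finset.sum_comm]; exact e3
  rw [e1, e2, e3, e4]
  ring

/-- The vector `ω^(-bi) v_i / α_i - ω^(-bj) v_j / α_j`. -/
def defect (α : Fin d → ℝ) (v : Fin d → K) (b i j : Fin d) : K :=
  ((α i)⁻¹ : ℂ) • conj (omega d) ^ ((b : ℕ) * i) • v i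
    - ((α j)⁻¹ : ℂ) • conj (omega d) ^ ((b : ℕ) * j) • v j

lemma inner_phase_smul (n : ℕ) (x : K) (T : K →ₗ[ℂ] K) :
    ⟪conj (omega d) ^ n • x, T (conj (omega d) ^ n • x)⟫_ℂ = ⟪x, T x⟫_ℂ := by
  rw [map_smul, inner_smul_left, inner_smul_right, map_pow, Complex.conj_conj, ← mul_assoc,
    omega_pow_mul_conj_pow, one_mul]

/-- Sum-of-squares decomposition of the steering functional. -/
lemma steering_sum_of_squares (hd : 2 ≤ d) (hα : ∀ i, 0 < α i) {ψ : Qudit d ⊗[ℂ] K}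
    (hψ : ‖ψ‖ = 1) {A C : Fin d → K →ₗ[ℂ] K} (hA : IsPOVM A) (hC : IsPOVM C) :
    ∑ k ∈ Finset.Ico 1 d,
      (expect ψ (TensorProduct.map (Z d ^ k) (genObs A k))
        + (gammaCoeff α : ℂ) * expect ψ (TensorProduct.map (X d ^ k) (genObs C k))
        + deltaCoeff α k * expect ψ (TensorProduct.map (Z d ^ k) 1))
    = d - d * ∑ i, ∑ b ∈ Finset.univ.erase (-i), ⟪component ψ i, A b (component ψ i)⟫_ℂ
      - (gammaCoeff α : ℂ) * ((1 / 2) * ∑ b, ∑ i, ∑ j, ((α i * α j : ℝ) : ℂ) *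
        ⟪defect α (component ψ) b i j, C b (defect α (component ψ) b i j)⟫_ℂ) := by
  set v := component ψ with hv
  have hnorm : ∑ i, ⟪v i, v i⟫_ℂ = 1 := by
    have := sum_norm_component_sq ψ
    rw [hψ] at this
    have h2 : ∀ i, ⟪v i, v i⟫_ℂ = (‖v i‖ : ℂ) ^ 2 := fun i => inner_self_eq_norm_sq_to_K _
    simp only [h2]
    exact_mod_cast this.trans (one_pow 2)
  have hexp1 : expect ψ 1 = 1 := by
    rw [expect_one, hψ]; simp
  -- Orthogonality needs the full range of k. The added term k = 0 equals 1 + γ + δ_0 = γ.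
  have h0 := Finset.sum_eq_sum_Ico_succ_bot (by omega : 0 < d) (fun k =>
      (expect ψ (TensorProduct.map (Z d ^ k) (genObs A k))
        + (gammaCoeff α : ℂ) * expect ψ (TensorProduct.map (X d ^ k) (genObs C k))
        + deltaCoeff α k * expect ψ (TensorProduct.map (Z d ^ k) 1)))
  rw [← Finset.range_eq_Ico, ← Fin.sum_univ_eq_sum_range] at h0
  simp only [Finset.sum_add_distrib, ← Finset.mul_sum, expect_map_X_pow, expect_map_Z_pow,
    Module.End.one_apply, ← hv, sum_Z_genObs, sum_X_genObs, sum_delta] at h0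
  simp only [pow_zero, zero_mul, one_mul, genObs_zero hA, genObs_zero hC, TensorProduct.map_one,
    hexp1, hnorm, deltaCoeff_zero hd hα, Module.End.one_apply] at h0
  have hApart : ∑ i, ∑ b ∈ Finset.univ.erase (-i), ⟪v i, A b (v i)⟫_ℂ
      = 1 - ∑ i, ⟪v i, A (-i) (v i)⟫_ℂ := by
    rw [← hnorm, ← Finset.sum_sub_distrib]
    refine Finset.sum_congr rfl fun i _ => ?_
    rw [eq_sub_iff_add_eq, Finset.sum_erase_add _ _ (Finset.mem_univ _), ← inner_sum,
      ← LinearMap.sum_apply, hA.2, Module.End.one_apply]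
  -- The `+ 1` is ∑ ⟨v_l, v_l⟩: the Cauchy–Schwarz weight of v_l is its row ratio plus one.
  -- Multiplied by γ, it accounts for the k = 0 term.
  have hCpart : (1 / 2) * ∑ b, ∑ i, ∑ j, ((α i * α j : ℝ) : ℂ) *
        ⟪defect α v b i j, C b (defect α v b i j)⟫_ℂ
      = ∑ l, (rowRatio α l : ℂ) * ⟪v l, v l⟫_ℂ + 1
        - ∑ b, ⟪fourier v b, C b (fourier v b)⟫_ℂ := by
    have h1 : ∀ b, (1 / 2) * ∑ i, ∑ j, ((α i * α j : ℝ) : ℂ) *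
        ⟪defect α v b i j, C b (defect α v b i j)⟫_ℂ
        = ∑ j, (((∑ i, α i) / α j : ℝ) : ℂ) * ⟪v j, C b (v j)⟫_ℂ
          - ⟪fourier v b, C b (fourier v b)⟫_ℂ := fun b => by
      have := cauchySchwarz_defect hα (fun j => conj (omega d) ^ ((b : ℕ) * j) • v j) (C b)
      simp only [inner_phase_smul] at this
      exact this.symm
    rw [Finset.mul_sum]
    simp only [h1, Finset.sum_sub_distrib]
    congr 1
    rw [Finset.sum_comm, ← hnorm, ← Finset.sum_add_distrib]
    refine Finset.sum_congr rfl fun j _ => ?_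
    rw [← Finset.mul_sum, ← inner_sum, ← LinearMap.sum_apply, hC.2, Module.End.one_apply,
      ← rowRatio_add_one hα]
    push_cast; ring
  rw [hApart, hCpart]
  simp only [zero_add] at h0
  simp only [Finset.sum_add_distrib, ← Finset.mul_sum, expect_map_Z_pow, ← hv,
    Module.End.one_apply]
  linear_combination -h0

end SumOfSquares

/-! ### Vanishing deficit -/

section MaximalViolation

variable {d : ℕ} {HB HE : Type*}
  [NormedAddCommGroup HB] [InnerProductSpace ℂ HB]
  [NormedAddCommGroup HE] [InnerProductSpace ℂ HE]

lemma IsPOVM.map_one {O : Type*} [Fintype O] [FiniteDimensional ℂ HB] [FiniteDimensional ℂ HE]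
    {M : O → HB →ₗ[ℂ] HB} (hM : IsPOVM M) :
    IsPOVM fun b => TensorProduct.map (M b) (1 : HE →ₗ[ℂ] HE) := by
  refine ⟨fun b => isPositive_map (hM.1 b) LinearMap.isPositive_one, ?_⟩
  simp only [← TensorProduct.mapBilinear_apply, ← LinearMap.sum_apply, ← map_sum, hM.2]
  simp [TensorProduct.mapBilinear_apply]

lemma map_genObs (M : Fin d → HB →ₗ[ℂ] HB) (k : ℕ) :
    TensorProduct.map (genObs M k) (1 : HE →ₗ[ℂ] HE)
      = genObs (fun b => TensorProduct.map (M b) 1) k := by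
  simp only [genObs, ← TensorProduct.mapBilinear_apply, map_sum, map_smul, LinearMap.sum_apply,
    LinearMap.smul_apply]

/-- The total weight of the terms by which the steering functional falls short of `d`. -/
def Realization.deficit [NeZero d] (r : Realization d HB HE) (α : Fin d → ℝ) : ℝ :=
  d * ∑ i, ∑ b ∈ Finset.univ.erase (-i),
      (⟪component r.ψ i, TensorProduct.map (r.B₀ b) 1 (component r.ψ i)⟫_ℂ).re
    + gammaCoeff α * ((1 / 2) * ∑ b, ∑ i, ∑ j, (α i * α j) *
      (⟪defect α (component r.ψ) b i j,
        TensorProduct.map (r.B₁ b) 1 (defect α (component r.ψ) b i j)⟫_ℂ).re)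

variable [NeZero d] [FiniteDimensional ℂ HB] [FiniteDimensional ℂ HE] {α : Fin d → ℝ}

lemma Realization.value_eq (hd : 2 ≤ d) (hα : ∀ i, 0 < α i) (r : Realization d HB HE) :
    r.value α = d - r.deficit α := by
  have h := steering_sum_of_squares hd hα r.norm_ψ (r.povm_B₀.map_one (HE := HE))
    (r.povm_B₁.map_one (HE := HE))
  simp only [← map_genObs] at h
  rw [Realization.value]
  simp only [tri, TensorProduct.map_one]
  rw [h]
  rw [show (1 / 2 : ℂ) = ((1 / 2 : ℝ) : ℂ) by push_cast; rfl, ← Complex.ofReal_natCast,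
    Complex.sub_re, Complex.sub_re, Complex.re_ofReal_mul, Complex.re_ofReal_mul,
    Complex.re_ofReal_mul]
  simp only [Complex.re_sum, Complex.re_ofReal_mul, Complex.ofReal_re, Realization.deficit]
  ring

lemma Realization.deficit_nonneg (hd : 2 ≤ d) (hα : ∀ i, 0 < α i) (r : Realization d HB HE) :
    0 ≤ r.deficit α := by
  refine add_nonneg (mul_nonneg (Nat.cast_nonneg _) ?_)
    (mul_nonneg (gammaCoeff_pos hd hα).le (mul_nonneg (by norm_num) ?_))
  · exact Finset.sum_nonneg fun i _ => Finset.sum_nonneg fun b _ =>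
      ((r.povm_B₀.map_one (HE := HE)).1 b).re_inner_nonneg_right _
  · exact Finset.sum_nonneg fun b _ => Finset.sum_nonneg fun i _ => Finset.sum_nonneg fun j _ =>
      mul_nonneg (mul_pos (hα i) (hα j)).le
        (((r.povm_B₁.map_one (HE := HE)).1 b).re_inner_nonneg_right _)

/-- A vanishing sum of nonnegative terms vanishes termwise, and a positive operator whose form
vanishes on a vector annihilates that vector. -/
lemma Realization.deficit_eq_zero_iff (hd : 2 ≤ d) (hα : ∀ i, 0 < α i)
    (r : Realization d HB HE) : r.deficit α = 0 ↔
      (∀ i b, b ≠ -i → TensorProduct.map (r.B₀ b) (1 : HE →ₗ[ℂ] HE) (component r.ψ i) = 0) ∧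
      ∀ b i j, TensorProduct.map (r.B₁ b) (1 : HE →ₗ[ℂ] HE)
        (defect α (component r.ψ) b i j) = 0 := by
  constructor
  · intro h
    have hA := fun b => (r.povm_B₀.map_one (HE := HE)).1 b
    have hC := fun b => (r.povm_B₁.map_one (HE := HE)).1 b
    have nA : ∀ i b, 0 ≤ (⟪component r.ψ i,
        TensorProduct.map (r.B₀ b) 1 (component r.ψ i)⟫_ℂ).re :=
      fun i b => (hA b).re_inner_nonneg_right _
    have nC : ∀ b i j, 0 ≤ (α i * α j) * (⟪defect α (component r.ψ) b i j,
        TensorProduct.map (r.B₁ b) 1 (defect α (component r.ψ) b i j)⟫_ℂ).re :=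
      fun b i j => mul_nonneg (mul_pos (hα i) (hα j)).le ((hC b).re_inner_nonneg_right _)
    have sA := Finset.sum_nonneg fun i (_ : i ∈ (Finset.univ : Finset (Fin d))) =>
      Finset.sum_nonneg fun b (_ : b ∈ Finset.univ.erase (-i)) => nA i b
    have sC := Finset.sum_nonneg fun b (_ : b ∈ (Finset.univ : Finset (Fin d))) =>
      Finset.sum_nonneg fun i (_ : i ∈ (Finset.univ : Finset (Fin d))) =>
      Finset.sum_nonneg fun j (_ : j ∈ (Finset.univ : Finset (Fin d))) => nC b i j
    have hd0 : (0 : ℝ) < d := by exact_mod_cast (by omega : 0 < d)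
    have hγ := gammaCoeff_pos hd hα
    rw [Realization.deficit, add_eq_zero_iff_of_nonneg (mul_nonneg hd0.le sA)
      (mul_nonneg hγ.le (mul_nonneg (by norm_num) sC))] at h
    constructor
    · have h1 := (mul_eq_zero.1 h.1).resolve_left hd0.ne'
      intro i b hb
      rw [Finset.sum_eq_zero_iff_of_nonneg (fun i _ => Finset.sum_nonneg fun b _ => nA i b)] at h1
      have h2 := h1 i (Finset.mem_univ _)
      rw [Finset.sum_eq_zero_iff_of_nonneg (fun b _ => nA i b)] at h2
      exact apply_eq_zero_of_inner_eq_zero (hA b)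
        (h2 b (Finset.mem_erase.2 ⟨hb, Finset.mem_univ _⟩))
    · have h1 := (mul_eq_zero.1 ((mul_eq_zero.1 h.2).resolve_left hγ.ne')).resolve_left
        (by norm_num)
      intro b i j
      rw [Finset.sum_eq_zero_iff_of_nonneg (fun b _ => Finset.sum_nonneg fun i _ =>
        Finset.sum_nonneg fun j _ => nC b i j)] at h1
      have h2 := h1 b (Finset.mem_univ _)
      rw [Finset.sum_eq_zero_iff_of_nonneg (fun i _ =>
        Finset.sum_nonneg fun j _ => nC b i j)] at h2
      have h3 := h2 i (Finset.mem_univ _)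
      rw [Finset.sum_eq_zero_iff_of_nonneg (fun j _ => nC b i j)] at h3
      exact apply_eq_zero_of_inner_eq_zero (hC b)
        ((mul_eq_zero.1 (h3 j (Finset.mem_univ _))).resolve_left (mul_pos (hα i) (hα j)).ne')
  · rintro ⟨h1, h2⟩
    rw [Realization.deficit, Finset.sum_eq_zero, mul_zero, zero_add]
    · simp [h2]
    · intro i _
      refine Finset.sum_eq_zero fun b hb => ?_
      rw [h1 i b (Finset.ne_of_mem_erase hb), inner_zero_right, Complex.zero_re]

end MaximalViolation

/-! ### The ideal realisation and the quantum maximum -/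

section Ideal

variable {d : ℕ} [NeZero d] {α : Fin d → ℝ}

/-- The shared state of the ideal realisation, with a trivial system for the eavesdropper. -/
def idealTripartite (α : Fin d → ℝ) : Qudit d ⊗[ℂ] (Qudit d ⊗[ℂ] ℂ) :=
  ∑ i, ket i ⊗ₜ[ℂ] ((α i : ℂ) • (ket i ⊗ₜ[ℂ] (1 : ℂ)))

omit [NeZero d] in
lemma component_idealTripartite (i : Fin d) :
    component (idealTripartite α) i = (α i : ℂ) • (ket i ⊗ₜ[ℂ] (1 : ℂ)) :=
  component_sum_ket _ i

omit [NeZero d] in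
lemma norm_ket (i : Fin d) : ‖(ket i : Qudit d)‖ = 1 := by simp [ket]

omit [NeZero d] in
lemma norm_idealTripartite (hα1 : ∑ i, α i ^ 2 = 1) : ‖idealTripartite α‖ = 1 := by
  have h := sum_norm_component_sq (idealTripartite α)
  simp only [component_idealTripartite, norm_smul, TensorProduct.norm_tmul, norm_ket, norm_one,
    mul_one, Complex.norm_real, Real.norm_eq_abs, sq_abs, hα1] at h
  exact (pow_eq_one_iff_of_nonneg (norm_nonneg _) two_ne_zero).1 h.symm

omit [NeZero d] in
lemma isPOVM_computational : IsPOVM fun b : Fin d => ketbra (ket (-b)) (ket (-b) : Qudit d) := by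
  refine ⟨fun b => isPositive_ketbra _, linearMap_ext_ket fun i => ?_⟩
  rw [LinearMap.sum_apply, Finset.sum_eq_single (-i)]
  · simp [ketbra_apply, norm_ket]
  · intro b _ hb
    have : -b ≠ i := by rintro rfl; simp at hb
    simp [ketbra_apply, inner_ket, ket_apply, this]
  · simp

/-- The Fourier basis is chosen with conjugate phases so that element b sends |i⟩ to ω^(bi) times
its value at |0⟩, which is the equality case of Cauchy–Schwarz. -/
lemma isPOVM_fourier :
    IsPOVM fun b : Fin d => (1 / d : ℂ) • ketbra (fourier ket b) (fourier ket b : Qudit d) := by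
  have hd : (d : ℂ) ≠ 0 := Nat.cast_ne_zero.2 (NeZero.ne d)
  refine ⟨fun b => (isPositive_ketbra _).smul_of_nonneg ?_, ext_inner_ket fun i j => ?_⟩
  · rw [one_div, ← Complex.ofReal_natCast, ← Complex.ofReal_inv]
    exact Complex.zero_le_real.2 (by positivity)
  have h : ∀ b i : Fin d, fourier ket b i = conj (omega d) ^ ((b : ℕ) * i) := fun b i => by
    simp [fourier, ket_apply]
  have h2 : ∀ b j : Fin d, ⟪fourier ket b, ket j⟫_ℂ = omega d ^ ((b : ℕ) * j) := fun b j => by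
    rw [← inner_conj_symm, inner_ket, h, map_pow, Complex.conj_conj]
  simp only [LinearMap.sum_apply, LinearMap.smul_apply, inner_sum, inner_smul_right, ketbra_apply,
    inner_ket, h, h2, ← Finset.mul_sum, sum_omega_pow_mul_conj_pow, Module.End.one_apply, ket_apply]
  by_cases hij : i = j
  · simp [hij, hd]
  · simp [hij, Ne.symm hij]

/-- The ideal realisation. -/
def idealRealization (α : Fin d → ℝ) (hα1 : ∑ i, α i ^ 2 = 1) : Realization d (Qudit d) ℂ where
  ψ := idealTripartite α
  norm_ψ := norm_idealTripartite hα1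
  B₀ := _
  B₁ := _
  povm_B₀ := isPOVM_computational
  povm_B₁ := isPOVM_fourier

lemma value_idealRealization (hd : 2 ≤ d) (hα : ∀ i, 0 < α i) (hα1 : ∑ i, α i ^ 2 = 1) :
    (idealRealization α hα1).value α = d := by
  rw [Realization.value_eq hd hα, sub_eq_self, Realization.deficit_eq_zero_iff hd hα]
  have hne : ∀ i, (α i : ℂ) ≠ 0 := fun i => Complex.ofReal_ne_zero.2 (hα i).ne'
  have h2 : ∀ b j : Fin d, ⟪fourier ket b, ket j⟫_ℂ = omega d ^ ((b : ℕ) * j) := fun b j => by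
    rw [← inner_conj_symm, inner_ket]
    simp [fourier, ket_apply]
  refine ⟨fun i b hb => ?_, fun b i j => ?_⟩
  · have : -b ≠ i := by rintro rfl; simp at hb
    simp [idealRealization, component_idealTripartite, ketbra_apply, inner_ket, ket_apply, this]
  · simp only [idealRealization, defect, component_idealTripartite, map_sub, map_smul,
      TensorProduct.map_tmul, LinearMap.smul_apply, ketbra_apply, h2, TensorProduct.smul_tmul',
      smul_smul]
    have e : ∀ i : Fin d, (α i : ℂ)⁻¹ * (conj (omega d) ^ ((b : ℕ) * i) * α i) *
        (1 / d * omega d ^ ((b : ℕ) * i)) = 1 / d := fun i => by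
      linear_combination (1 / d : ℂ) * omega_pow_mul_conj_pow (d := d) ((b : ℕ) * i) +
        (1 / d : ℂ) * omega d ^ ((b : ℕ) * i) * conj (omega d) ^ ((b : ℕ) * i) *
          inv_mul_cancel₀ (hne i)
    rw [e, e, sub_self]

lemma isGreatest_quantumValues (hd : 2 ≤ d) (hα : ∀ i, 0 < α i) (hα1 : ∑ i, α i ^ 2 = 1) :
    IsGreatest (quantumValues α) d := by
  refine ⟨⟨Qudit d, ℂ, inferInstance, inferInstance, inferInstance, inferInstance, inferInstance,
    inferInstance, idealRealization α hα1, (value_idealRealization hd hα hα1).symm⟩, ?_⟩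
  rintro _ ⟨HB, HE, _, _, _, _, _, _, r, rfl⟩
  rw [r.value_eq hd hα]
  linarith [r.deficit_nonneg hd hα]

lemma Realization.violatesMaximally_iff {HB HE : Type*}
    [NormedAddCommGroup HB] [InnerProductSpace ℂ HB] [FiniteDimensional ℂ HB]
    [NormedAddCommGroup HE] [InnerProductSpace ℂ HE] [FiniteDimensional ℂ HE]
    (hd : 2 ≤ d) (hα : ∀ i, 0 < α i) (hα1 : ∑ i, α i ^ 2 = 1) (r : Realization d HB HE) :
    r.ViolatesMaximally α ↔ r.deficit α = 0 := by
  have h := isGreatest_quantumValues hd hα hα1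
  have hv := r.value_eq hd hα
  constructor
  · intro hr
    have := hr.unique h
    linarith
  · intro hr
    rw [Realization.ViolatesMaximally, hv, hr, sub_zero]
    exact h

end Ideal

/-! ### Using extremality -/

section Extremal

variable {O H : Type*} [Fintype O] [NormedAddCommGroup H] [InnerProductSpace ℂ H]

/-- Operators dominated by an extremal POVM that sum to `q` are `q` times that POVM. -/
lemma IsExtremalPOVM.eq_smul {I N : O → H →ₗ[ℂ] H} (hI : IsExtremalPOVM I)
    {q : ℝ} (hq0 : 0 ≤ q) (hq1 : q ≤ 1) (hN : ∀ b, (N b).IsPositive)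
    (hIN : ∀ b, (I b - N b).IsPositive) (hsum : ∑ b, N b = (q : ℂ) • 1) (b : O) :
    N b = (q : ℂ) • I b := by
  have hI0 : IsPOVM I := hI.1
  have hpos : ∀ {c : ℝ}, 0 ≤ c → ∀ b, ((c : ℂ) • I b).IsPositive := fun hc b =>
    (hI0.1 b).smul_of_nonneg (Complex.zero_le_real.2 hc)
  -- The POVMs (1-q)I + N and (I-N) + qI have mean I, so extremality makes the first equal to I.
  -- Dividing N by q is avoided, and q = 0 needs no separate treatment.
  have h1 : IsPOVM fun b => ((1 - q : ℝ) : ℂ) • I b + N b := by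
    refine ⟨fun b => (hpos (sub_nonneg.2 hq1) b).add (hN b), ?_⟩
    rw [Finset.sum_add_distrib, ← Finset.smul_sum, hI0.2, hsum, ← add_smul]
    simp
  have h2 : IsPOVM fun b => (I b - N b) + (q : ℂ) • I b := by
    refine ⟨fun b => (hIN b).add (hpos hq0 b), ?_⟩
    rw [Finset.sum_add_distrib, Finset.sum_sub_distrib, ← Finset.smul_sum, hI0.2, hsum]
    simp
  have h3 := hI.2 h1 h2 ⟨1 / 2, 1 / 2, by norm_num, by norm_num, by norm_num, by
    ext b x
    simp only [Pi.add_apply, Pi.smul_apply, LinearMap.add_apply, LinearMap.smul_apply,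
      LinearMap.sub_apply, ← Complex.coe_smul]
    push_cast
    module⟩
  have h4 := congrFun h3 b
  push_cast at h4
  rw [sub_smul, one_smul] at h4
  rw [← sub_eq_zero, show N b - (q : ℂ) • I b = (I b - (q : ℂ) • I b + N b) - I b by abel, h4,
    sub_self]

end Extremal

/-! ### Decoupling of Eve, and completeness of the Weyl operators -/

section Decoupling

variable {d : ℕ} [NeZero d] {K : Type*} [NormedAddCommGroup K] [InnerProductSpace ℂ K]

/-- An operator that commutes with Bob's measurements cannot tell the vectors `ξ_i` apart. -/
lemma inner_decoupled {A C : Fin d → K →ₗ[ℂ] K} (hA : IsPOVM A) (hC : IsPOVM C) {ξ : Fin d → K}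
    (hAξ : ∀ i b, b ≠ -i → A b (ξ i) = 0)
    (hCξ : ∀ b i j : Fin d, C b (conj (omega d) ^ ((b : ℕ) * i) • ξ i
      - conj (omega d) ^ ((b : ℕ) * j) • ξ j) = 0)
    {G : K →ₗ[ℂ] K} (hGA : ∀ b x, G (A b x) = A b (G x)) (hGC : ∀ b x, G (C b x) = C b (G x))
    (i j : Fin d) : ⟪ξ i, G (ξ j)⟫_ℂ = if i = j then ⟪ξ 0, G (ξ 0)⟫_ℂ else 0 := by
  have hC' : ∀ b i, C b (ξ i) = omega d ^ ((b : ℕ) * i) • C b (ξ 0) := fun b i => by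
    have h := hCξ b i 0
    rw [map_sub, map_smul, map_smul, sub_eq_zero] at h
    simp only [Fin.val_zero, mul_zero, pow_zero, one_smul] at h
    rw [← h, smul_smul, omega_pow_mul_conj_pow, one_smul]
  have hexp : ∀ x, ∑ b, C b x = x := fun x => by
    rw [← LinearMap.sum_apply, hC.2, Module.End.one_apply]
  -- Insert ∑ C_b = 1 once, commute C_b past G, and move it to the left vector. For i = j the phases
  -- cancel, so the value does not depend on i.
  have hform : ∀ i j, ⟪ξ i, G (ξ j)⟫_ℂ = ∑ b : Fin d, omega d ^ ((b : ℕ) * j) *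
      (conj (omega d) ^ ((b : ℕ) * i) * ⟪C b (ξ 0), G (ξ 0)⟫_ℂ) := fun i j => by
    conv_lhs => rw [← hexp (ξ j), map_sum, inner_sum]
    refine Finset.sum_congr rfl fun b _ => ?_
    rw [hC' b j, map_smul, inner_smul_right, hGC, ← (hC.1 b).isSymmetric, hC' b i,
      inner_smul_left, map_pow]
  split_ifs with h
  · subst h
    rw [hform i i, hform 0 0]
    refine Finset.sum_congr rfl fun b _ => ?_
    rw [← mul_assoc, omega_pow_mul_conj_pow]
    simp
  · have hAi : ∀ i, A (-i) (ξ i) = ξ i := fun i => by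
      have h1 : ∑ b, A b (ξ i) = ξ i := by
        rw [← LinearMap.sum_apply, hA.2, Module.End.one_apply]
      rwa [Finset.sum_eq_single (-i) (fun b _ hb => hAξ i b hb) (by simp)] at h1
    -- A_{-i} fixes ξ_i and kills ξ_j; moving it across G gives zero.
    rw [← hAi i, (hA.1 _).isSymmetric, ← hGA, hAξ j (-i) (fun h2 => h (neg_injective h2)),
      map_zero, inner_zero_right]

/-- A function on `ℤ/d` whose Fourier transform vanishes is zero. -/
lemma eq_zero_of_fourier_eq_zero {f : Fin d → ℂ}
    (h : ∀ k : Fin d, ∑ i : Fin d, omega d ^ ((k : ℕ) * i) * f i = 0) (j : Fin d) : f j = 0 := by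
  have h1 : ∑ k : Fin d, conj (omega d) ^ ((k : ℕ) * j) *
      ∑ i : Fin d, omega d ^ ((k : ℕ) * i) * f i = d * f j := by
    simp only [Finset.mul_sum]
    rw [Finset.sum_comm]
    have : ∀ i k : Fin d, conj (omega d) ^ ((k : ℕ) * j) * (omega d ^ ((k : ℕ) * i) * f i)
        = (omega d ^ ((k : ℕ) * i) * conj (omega d) ^ ((k : ℕ) * j)) * f i := fun i k => by ring
    simp only [this, ← Finset.sum_mul, sum_omega_pow_mul_conj_pow, ite_mul, zero_mul,
      Finset.sum_ite_eq', Finset.mem_univ, if_true]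
  simp only [h, mul_zero, Finset.sum_const_zero] at h1
  exact (mul_eq_zero.1 h1.symm).resolve_left (Nat.cast_ne_zero.2 (NeZero.ne d))

/-- The operators `X^i Z^j` span the operators on `ℂ^d`. -/
lemma eq_zero_of_weyl_sum_eq_zero {F : Fin d → Fin d → ℂ}
    (h : ∀ i j : Fin d, ∑ k, ∑ l,
      ⟪ket k, (X d ^ (i : ℕ) * Z d ^ (j : ℕ)) (ket l)⟫_ℂ * F k l = 0) (k l : Fin d) :
    F k l = 0 := by
  -- X^i Z^j sees only the cyclic diagonal F (m+i) m, with phases ω^(jm). Varying j gives the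
  -- Fourier transform of that diagonal.
  have h1 := eq_zero_of_fourier_eq_zero (f := fun m => F (m + (k - l)) m) (fun j => ?_) l
  · simpa using h1
  · have h2 := h (k - l) j
    rw [Finset.sum_comm] at h2
    simpa only [Module.End.mul_apply, Z_pow_ket, map_smul, X_pow_ket, inner_smul_right, inner_ket,
      ket_apply, mul_ite, mul_one, mul_zero, ite_mul, zero_mul, Finset.sum_ite_eq',
      Finset.sum_ite_eq, Finset.mem_univ, if_true] using h2

end Decoupling

/-! ### Traces against Bob's reduced state -/

section ReducedState

variable {d : ℕ} {α : Fin d → ℝ}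

lemma component_idealState (i : Fin d) : component (idealState α) i = (α i : ℂ) • ket i := by
  simp only [idealState, ← TensorProduct.tmul_smul]
  exact component_sum_ket _ i

lemma trace_comp_ketbra {H : Type*} [NormedAddCommGroup H] [InnerProductSpace ℂ H]
    [FiniteDimensional ℂ H] (T : H →ₗ[ℂ] H) (x y : H) :
    LinearMap.trace ℂ H (T ∘ₗ ketbra x y) = ⟪y, T x⟫_ℂ := by
  have : T ∘ₗ ketbra x y = ketbra (T x) y := by
    ext z; simp [ketbra_apply]
  rw [this]
  exact InnerProductSpace.trace_rankOne _ _

lemma trace_comp_reducedState (T : Qudit d →ₗ[ℂ] Qudit d) :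
    LinearMap.trace ℂ (Qudit d) (T ∘ₗ reducedState (idealState α))
      = ∑ i, ((α i ^ 2 : ℝ) : ℂ) * ⟪ket i, T (ket i)⟫_ℂ := by
  have h : ∀ i, partialBra i (idealState α) = (α i : ℂ) • ket i := component_idealState
  have h1 : T ∘ₗ reducedState (idealState α)
      = ∑ i, T ∘ₗ ketbra (partialBra i (idealState α)) (partialBra i (idealState α)) := by
    ext x; simp [reducedState]
  rw [h1, map_sum]
  refine Finset.sum_congr rfl fun i _ => ?_
  rw [trace_comp_ketbra, h, map_smul, inner_smul_left, inner_smul_right, Complex.conj_ofReal]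
  push_cast; ring

end ReducedState

/-! ### Eve's guess under certification -/

section Guessing

variable {d : ℕ}

/-- The linear map `ℂ^d → K` that sends `|i⟩` to `ξ_i`. -/
def ketMap {K : Type*} [NormedAddCommGroup K] [InnerProductSpace ℂ K] (ξ : Fin d → K) :
    Qudit d →ₗ[ℂ] K := ∑ i, (innerₛₗ ℂ (ket i)).smulRight (ξ i)

lemma ketMap_ket {K : Type*} [NormedAddCommGroup K] [InnerProductSpace ℂ K] (ξ : Fin d → K)
    (i : Fin d) : ketMap ξ (ket i) = ξ i := by
  simp [ketMap, inner_ket, ket_apply]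

/-- The operator on `ℂ^d` with matrix `⟨ξ_i|T|ξ_j⟩`. -/
def compression {K : Type*} [NormedAddCommGroup K] [InnerProductSpace ℂ K]
    [FiniteDimensional ℂ K] (ξ : Fin d → K) (T : K →ₗ[ℂ] K) : Qudit d →ₗ[ℂ] Qudit d :=
  LinearMap.adjoint (ketMap ξ) ∘ₗ T ∘ₗ ketMap ξ

lemma inner_compression {K : Type*} [NormedAddCommGroup K] [InnerProductSpace ℂ K]
    [FiniteDimensional ℂ K] (ξ : Fin d → K) (T : K →ₗ[ℂ] K) (i j : Fin d) :
    ⟪ket i, compression ξ T (ket j)⟫_ℂ = ⟪ξ i, T (ξ j)⟫_ℂ := by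
  simp [compression, LinearMap.adjoint_inner_right, ketMap_ket]

lemma compression_sum {ι K : Type*} [Fintype ι] [NormedAddCommGroup K] [InnerProductSpace ℂ K]
    [FiniteDimensional ℂ K] (ξ : Fin d → K) (T : ι → K →ₗ[ℂ] K) :
    compression ξ (∑ b, T b) = ∑ b, compression ξ (T b) := by
  ext1 x
  simp [compression]

lemma expect_eq_sum_compression {K : Type*} [NormedAddCommGroup K] [InnerProductSpace ℂ K]
    [FiniteDimensional ℂ K] {α : Fin d → ℝ} (hα : ∀ i, 0 < α i) (ψ : Qudit d ⊗[ℂ] K)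
    (S : Qudit d →ₗ[ℂ] Qudit d) (T : K →ₗ[ℂ] K) :
    expect ψ (TensorProduct.map S T) = ∑ i, ∑ j, ⟪ket i, S (ket j)⟫_ℂ * ((α i * α j : ℝ) *
      ⟪ket i, compression (fun i => ((α i)⁻¹ : ℂ) • component ψ i) T (ket j)⟫_ℂ) := by
  rw [expect_map]
  refine Finset.sum_congr rfl fun i _ => Finset.sum_congr rfl fun j _ => ?_
  have hi : (α i : ℂ) ≠ 0 := Complex.ofReal_ne_zero.2 (hα i).ne'
  have hj : (α j : ℂ) ≠ 0 := Complex.ofReal_ne_zero.2 (hα j).ne'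
  rw [inner_compression, map_smul, inner_smul_left, inner_smul_right, map_inv₀,
    Complex.conj_ofReal]
  push_cast
  field_simp

variable [NeZero d] {O HB HE : Type*} [Fintype O]
  [NormedAddCommGroup HB] [InnerProductSpace ℂ HB] [FiniteDimensional ℂ HB]
  [NormedAddCommGroup HE] [InnerProductSpace ℂ HE] [FiniteDimensional ℂ HE]
  {α : Fin d → ℝ} {I : O → Qudit d →ₗ[ℂ] Qudit d}

/-- The components of the shared state, divided by the Schmidt coefficients. -/
def Realization.xi (r : Realization d HB HE) (α : Fin d → ℝ) (i : Fin d) : HB ⊗[ℂ] HE :=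
  ((α i)⁻¹ : ℂ) • component r.ψ i

/-- Maximal violation decouples the eavesdropper. -/
lemma Realization.compression_eve (hd : 2 ≤ d) (hα : ∀ i, 0 < α i) (hα1 : ∑ i, α i ^ 2 = 1)
    (r : Realization d HB HE) (hr : r.ViolatesMaximally α) (V : HE →ₗ[ℂ] HE) :
    compression (r.xi α) (TensorProduct.map 1 V)
      = ⟪ket 0, compression (r.xi α) (TensorProduct.map 1 V) (ket 0)⟫_ℂ • 1 := by
  rw [r.violatesMaximally_iff hd hα hα1, r.deficit_eq_zero_iff hd hα] at hr
  have hcomm : ∀ (T : HB →ₗ[ℂ] HB) (x : HB ⊗[ℂ] HE), TensorProduct.map 1 V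
      (TensorProduct.map T 1 x) = TensorProduct.map T 1 (TensorProduct.map 1 V x) := fun T x => by
    rw [← LinearMap.comp_apply, ← LinearMap.comp_apply, ← TensorProduct.map_comp,
      ← TensorProduct.map_comp]
    rfl
  refine ext_inner_ket fun i j => ?_
  have h := inner_decoupled (r.povm_B₀.map_one (HE := HE)) (r.povm_B₁.map_one (HE := HE))
    (ξ := r.xi α) (fun i b hb => ?_) (fun b i j => ?_) (fun b x => hcomm _ x)
    (fun b x => hcomm _ x) i j
  · rw [inner_compression, inner_compression, h]
    simp [inner_ket, ket_apply]
  · rw [Realization.xi, map_smul, hr.1 i b hb, smul_zero]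
  · have := hr.2 b i j
    rw [defect, smul_comm, smul_comm ((α j : ℂ)⁻¹)] at this
    exact this

/-- The certification conditions determine Bob's POVM on the support of his reduced state. -/
lemma Strategy.compression_eq (hα : ∀ i, 0 < α i) (s : Strategy d O HB HE)
    (hm : s.MatchesPOVM α I) (b : O) :
    compression (s.xi α) (TensorProduct.map (s.R b) 1) = I b := by
  refine ext_inner_ket fun i j => ?_
  -- The conditions say that all Weyl moments of this weighted difference vanish; the weights α_k
  -- α_l are nonzero and can be cancelled.
  have h := eq_zero_of_weyl_sum_eq_zero (F := fun k l => ((α k * α l : ℝ) : ℂ) *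
    (⟪ket k, compression (s.xi α) (TensorProduct.map (s.R b) 1) (ket l)⟫_ℂ
      - ⟪ket k, I b (ket l)⟫_ℂ)) (fun i j => ?_) i j
  · refine sub_eq_zero.1 ((mul_eq_zero.1 h).resolve_left ?_)
    exact Complex.ofReal_ne_zero.2 (mul_pos (hα i) (hα j)).ne'
  · have h1 := hm b i j
    rw [tri, expect_eq_sum_compression hα, expect_map, ← sub_eq_zero,
      ← Finset.sum_sub_distrib] at h1
    rw [← h1]
    refine Finset.sum_congr rfl fun k _ => ?_
    rw [← Finset.sum_sub_distrib]
    refine Finset.sum_congr rfl fun l _ => ?_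
    rw [component_idealState, component_idealState, map_smul, inner_smul_left, inner_smul_right,
      Complex.conj_ofReal, mul_sub, mul_sub]
    congr 1
    push_cast; ring

/-- Decoupling fixes the sums of M c b over b, certification those over c, and extremality then
gives the product form q_c I_b: Eve's outcome carries no information about Bob's. -/
lemma Strategy.guess_eq (hd : 2 ≤ d) (hα : ∀ i, 0 < α i) (hα1 : ∑ i, α i ^ 2 = 1)
    (hI : IsExtremalPOVM I)
    (htr : ∀ b, LinearMap.trace ℂ (Qudit d) (I b ∘ₗ reducedState (idealState α))
      = 1 / (d : ℂ) ^ 2)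
    (s : Strategy d O HB HE) (hv : s.ViolatesMaximally α) (hm : s.MatchesPOVM α I) :
    s.guess = 1 / (d : ℝ) ^ 2 := by
  classical
  set M : O → O → Qudit d →ₗ[ℂ] Qudit d :=
    fun c b => compression (s.xi α) (TensorProduct.map (s.R b) (s.E c)) with hM
  set ξ := s.xi α with hξ
  have hMpos : ∀ c b, (M c b).IsPositive := fun c b =>
    (isPositive_map (s.povm_R.1 b) (s.povm_E.1 c)).adjoint_conj _
  have hEpos : ∀ c, (TensorProduct.map (1 : HB →ₗ[ℂ] HB) (s.E c)).IsPositive := fun c =>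
    isPositive_map LinearMap.isPositive_one (s.povm_E.1 c)
  have hFpos : ∀ c, (compression ξ (TensorProduct.map 1 (s.E c))).IsPositive := fun c =>
    (hEpos c).adjoint_conj _
  set q : O → ℝ := fun c =>
    (⟪ket 0, compression ξ (TensorProduct.map 1 (s.E c)) (ket 0)⟫_ℂ).re with hq
  have hq0 : ∀ c, 0 ≤ q c := fun c => (hFpos c).re_inner_nonneg_right _
  have hqc : ∀ c, ⟪ket 0, compression ξ (TensorProduct.map 1 (s.E c)) (ket 0)⟫_ℂ = q c := fun c =>
    ((hFpos c).isSymmetric.coe_re_inner_self_apply _).symm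
  have hMsum : ∀ c, ∑ b, M c b = (q c : ℂ) • 1 := fun c => by
    rw [← hqc, ← s.compression_eve hd hα hα1 hv, ← compression_sum, ← s.povm_R.2]
    congr 1
    simp only [← TensorProduct.mapBilinear_apply, map_sum, LinearMap.sum_apply]
  have hMI : ∀ b, ∑ c, M c b = I b := fun b => by
    rw [← s.compression_eq hα hm b, ← compression_sum, ← s.povm_E.2]
    congr 1
    simp only [← TensorProduct.mapBilinear_apply, map_sum]
  have hqsum : ∑ c, q c = 1 := by
    have h1 : ∑ c, ∑ b, M c b = 1 := by
      rw [Finset.sum_comm, Finset.sum_congr rfl fun b _ => hMI b, hI.1.2]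
    rw [Finset.sum_congr rfl fun c _ => hMsum c, ← Finset.sum_smul] at h1
    have h2 := congrArg (fun T : Qudit d →ₗ[ℂ] Qudit d => ⟪ket 0, T (ket 0)⟫_ℂ) h1
    simp only [LinearMap.smul_apply, Module.End.one_apply, inner_smul_right, inner_ket,
      ket_apply, if_true, mul_one] at h2
    exact_mod_cast h2
  have hq1 : ∀ c, q c ≤ 1 := fun c => by
    rw [← hqsum]
    exact Finset.single_le_sum (fun c _ => hq0 c) (Finset.mem_univ c)
  have hMq : ∀ c b, M c b = (q c : ℂ) • I b := fun c b => by
    refine hI.eq_smul (hq0 c) (hq1 c) (hMpos c) (fun b => ?_) (hMsum c) b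
    -- I_b minus one summand is the sum of the remaining positive M c b.
    rw [← hMI b, ← Finset.sum_erase_add _ _ (Finset.mem_univ c), add_sub_cancel_right]
    exact LinearMap.isPositive_sum _ fun c _ => hMpos c b
  have hterm : ∀ b, expect s.ψ (tri 1 (s.R b) (s.E b)) = ((q b / (d : ℝ) ^ 2 : ℝ) : ℂ) :=
      fun b => by
    rw [tri, expect_eq_sum_compression hα]
    have h1 : compression (fun i => ((α i)⁻¹ : ℂ) • component s.ψ i)
        (TensorProduct.map (s.R b) (s.E b)) = (q b : ℂ) • I b := hMq b b
    rw [h1]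
    have h2 := htr b
    rw [trace_comp_reducedState] at h2
    calc _ = q b * ∑ i, ((α i ^ 2 : ℝ) : ℂ) * ⟪ket i, I b (ket i)⟫_ℂ := by
          rw [Finset.mul_sum]
          refine Finset.sum_congr rfl fun i _ => ?_
          simp only [Module.End.one_apply, inner_ket, ket_apply, ite_mul, one_mul, zero_mul,
            Finset.sum_ite_eq, Finset.mem_univ, if_true]
          simp only [LinearMap.smul_apply, PiLp.smul_apply, smul_eq_mul]
          push_cast; ring
      _ = _ := by rw [h2]; push_cast; ring
  rw [Strategy.guess, Finset.sum_congr rfl fun b _ => hterm b, ← Complex.ofReal_sum,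
    Complex.ofReal_re, ← Finset.sum_div, hqsum]

end Guessing

/-! ### The set of guessing probabilities -/

section GuessingProbability

variable {d : ℕ} [NeZero d] {O : Type*} [Fintype O] {α : Fin d → ℝ}
  {I : O → Qudit d →ₗ[ℂ] Qudit d}

lemma isPOVM_uniform [Nonempty O] :
    IsPOVM fun _ : O => ((Fintype.card O : ℂ)⁻¹) • (1 : ℂ →ₗ[ℂ] ℂ) := by
  refine ⟨fun b => LinearMap.isPositive_one.smul_of_nonneg ?_, ?_⟩
  · rw [← Complex.ofReal_natCast, ← Complex.ofReal_inv]
    exact Complex.zero_le_real.2 (by positivity)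
  · rw [Finset.sum_const, Finset.card_univ, ← Nat.cast_smul_eq_nsmul ℂ, smul_smul,
      mul_inv_cancel₀ (Nat.cast_ne_zero.2 Fintype.card_ne_zero), one_smul]

/-- The ideal strategy, in which the eavesdropper guesses uniformly at random. -/
def idealStrategy [Nonempty O] (hα1 : ∑ i, α i ^ 2 = 1) (hI : IsPOVM I) :
    Strategy d O (Qudit d) ℂ where
  toRealization := idealRealization α hα1
  R := I
  E := _
  povm_R := hI
  povm_E := isPOVM_uniform

lemma idealStrategy_matchesPOVM [Nonempty O] (hα1 : ∑ i, α i ^ 2 = 1) (hI : IsPOVM I) :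
    (idealStrategy hα1 hI).MatchesPOVM α I := by
  intro b i j
  have hψ : (idealStrategy hα1 hI).ψ = idealTripartite α := rfl
  rw [tri, expect_map, expect_map, hψ]
  refine Finset.sum_congr rfl fun k _ => Finset.sum_congr rfl fun l _ => ?_
  rw [component_idealTripartite, component_idealTripartite, component_idealState,
    component_idealState]
  have hR : (idealStrategy hα1 hI).R b = I b := rfl
  simp only [hR, TensorProduct.smul_tmul', TensorProduct.map_tmul, TensorProduct.inner_tmul,
    Module.End.one_apply, map_smul, inner_smul_left, inner_smul_right, Complex.conj_ofReal,
    RCLike.inner_apply, map_one, mul_one]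

/-- The ideal strategy shows that the set is non-empty; its value need not be computed, since
`Strategy.guess_eq` applies to it too. -/
lemma guessValues_eq (hd : 2 ≤ d) (hα : ∀ i, 0 < α i) (hα1 : ∑ i, α i ^ 2 = 1)
    (hO : Fintype.card O = d ^ 2) (hI : IsExtremalPOVM I)
    (htr : ∀ b, LinearMap.trace ℂ (Qudit d) (I b ∘ₗ reducedState (idealState α))
      = 1 / (d : ℂ) ^ 2) :
    guessValues α I = {1 / (d : ℝ) ^ 2} := by
  have : Nonempty O := Fintype.card_pos_iff.1 (hO ▸ by positivity)
  refine Set.eq_singleton_iff_unique_mem.2 ⟨?_, ?_⟩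
  · have hv : (idealStrategy hα1 hI.1).ViolatesMaximally α := by
      rw [Realization.ViolatesMaximally,
        show (idealStrategy hα1 hI.1).value α = d from value_idealRealization hd hα hα1]
      exact isGreatest_quantumValues hd hα hα1
    have hm := idealStrategy_matchesPOVM hα1 hI.1
    exact ⟨Qudit d, ℂ, inferInstance, inferInstance, inferInstance, inferInstance, inferInstance,
      inferInstance, _, hv, hm, ((idealStrategy hα1 hI.1).guess_eq hd hα hα1 hI htr hv hm).symm⟩
  · rintro _ ⟨HB, HE, _, _, _, _, _, _, s, hv, hm, rfl⟩
    exact s.guess_eq hd hα hα1 hI htr hv hm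

/-- An extremal POVM with uniform outcomes on the reduced state certifies `2 log₂ d` bits. -/
theorem certified_randomness (hd : 2 ≤ d) (hα : ∀ i, 0 < α i) (hα1 : ∑ i, α i ^ 2 = 1)
    (hO : Fintype.card O = d ^ 2) (hI : IsExtremalPOVM I)
    (htr : ∀ b, LinearMap.trace ℂ (Qudit d) (I b ∘ₗ reducedState (idealState α))
      = 1 / (d : ℂ) ^ 2) :
    IsLUB (guessValues α I) (1 / (d : ℝ) ^ 2) ∧
      guessingProbability α I = 1 / (d : ℝ) ^ 2 ∧
      certifiedBits α I = 2 * Real.logb 2 d := by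
  have h := guessValues_eq hd hα hα1 hO hI htr
  have h2 : guessingProbability α I = 1 / (d : ℝ) ^ 2 := by
    rw [guessingProbability, h, csSup_singleton]
  refine ⟨h ▸ isLUB_singleton, h2, ?_⟩
  rw [certifiedBits, h2, one_div, Real.logb_inv, neg_neg, Real.logb_pow]
  norm_num

end GuessingProbability

/-! ### Extremality of rank-one POVMs -/

section RankOne

variable {O H : Type*} [Fintype O] [NormedAddCommGroup H] [InnerProductSpace ℂ H]

/-- A symmetric operator that vanishes on the complement of `w` is a multiple of `|w⟩⟨w|`. -/
lemma exists_eq_smul_ketbra {T : H →ₗ[ℂ] H} (hT : T.IsSymmetric) {w : H}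
    (h : ∀ x, ⟪w, x⟫_ℂ = 0 → T x = 0) : ∃ c : ℂ, T = c • ketbra w w := by
  by_cases hw : w = 0
  · exact ⟨0, by ext x; simpa using h x (by simp [hw])⟩
  have hw2 : ⟪w, w⟫_ℂ ≠ 0 := inner_self_ne_zero.2 hw
  -- ⟨w,w⟩x - ⟨w,x⟩w is orthogonal to w. This determines T by T w, and symmetry then makes T w
  -- parallel to w.
  have h1 : ∀ x, ⟪w, w⟫_ℂ • T x = ⟪w, x⟫_ℂ • T w := fun x => by
    have := h (⟪w, w⟫_ℂ • x - ⟪w, x⟫_ℂ • w) (by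
      rw [inner_sub_right, inner_smul_right, inner_smul_right]; ring)
    rwa [map_sub, map_smul, map_smul, sub_eq_zero] at this
  have h2 : ⟪w, w⟫_ℂ • T w = ⟪w, T w⟫_ℂ • w := by
    refine ext_inner_left ℂ fun y => ?_
    have := congrArg (fun v => ⟪v, w⟫_ℂ) (h1 y)
    simp only [inner_smul_left, inner_conj_symm] at this
    rw [inner_smul_right, inner_smul_right, ← hT, this, hT]
    ring
  refine ⟨⟪w, T w⟫_ℂ / ⟪w, w⟫_ℂ ^ 2, ?_⟩
  ext x
  have h3 : (⟪w, w⟫_ℂ ^ 2) • T x = (⟪w, x⟫_ℂ * ⟪w, T w⟫_ℂ) • w := by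
    rw [sq, mul_smul, h1, smul_comm, h2, smul_smul]
  rw [LinearMap.smul_apply, ketbra_apply, smul_smul, div_mul_eq_mul_div, div_eq_inv_mul, mul_smul,
    mul_comm, ← h3, inv_smul_smul₀ (pow_ne_zero 2 hw2)]

/-- A POVM with linearly independent elements of rank one is extremal. -/
lemma isExtremalPOVM_of_rankOne [FiniteDimensional ℂ H] {w : O → H}
    (hw : IsPOVM fun b => ketbra (w b) (w b))
    (hli : ∀ c : O → ℂ, ∑ b, c b • ketbra (w b) (w b) = 0 → ∀ b, c b = 0) :
    IsExtremalPOVM fun b => ketbra (w b) (w b) := by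
  refine ⟨hw, ?_⟩
  rintro N hN N' hN' ⟨s, t, hs, ht, -, hst⟩
  -- Where |w⟩⟨w| vanishes, both positive parts of the mixture vanish too. So N b is a multiple of
  -- |w⟩⟨w|, and linear independence fixes the multiple to be 1.
  have h1 : ∀ b x, ⟪w b, x⟫_ℂ = 0 → N b x = 0 := fun b x hx => by
    have h2 : s • N b x + t • N' b x = 0 := by
      have := LinearMap.congr_fun (congrFun hst b) x
      rw [ketbra_apply, hx, zero_smul] at this
      simpa using this
    have h3 : s * (⟪x, N b x⟫_ℂ).re + t * (⟪x, N' b x⟫_ℂ).re = 0 := by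
      have := congrArg (fun y => (⟪x, y⟫_ℂ).re) h2
      simpa [inner_add_right, ← Complex.coe_smul, inner_smul_right] using this
    have p1 : 0 ≤ (⟪x, N b x⟫_ℂ).re := (hN.1 b).re_inner_nonneg_right x
    have p2 : 0 ≤ (⟪x, N' b x⟫_ℂ).re := (hN'.1 b).re_inner_nonneg_right x
    refine apply_eq_zero_of_inner_eq_zero (hN.1 b) ?_
    have := (add_eq_zero_iff_of_nonneg (mul_nonneg hs.le p1) (mul_nonneg ht.le p2)).1 h3
    exact (mul_eq_zero.1 this.1).resolve_left hs.ne'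
  choose c hc using fun b => exists_eq_smul_ketbra (hN.1 b).isSymmetric (h1 b)
  have h2 : ∑ b, (c b - 1) • ketbra (w b) (w b) = 0 := by
    simp only [sub_smul, one_smul, Finset.sum_sub_distrib]
    rw [hw.2, ← hN.2, sub_eq_zero]
    exact Finset.sum_congr rfl fun b _ => (hc b).symm
  funext b
  rw [hc b, sub_eq_zero.1 (hli _ h2 b), one_smul]

end RankOne

/-! ### The Weyl-covariant POVM -/

section Weyl

variable {d : ℕ} [NeZero d]

lemma U_apply (k l : Fin d) (x : Qudit d) (i : Fin d) :
    U k l x i = omega d ^ ((l : ℕ) * (i - k : Fin d)) * x (i - k) := by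
  conv_lhs => rw [← sum_smul_ket x]
  simp only [map_sum, map_smul, U_ket]
  rw [WithLp.ofLp_sum, Finset.sum_apply, Finset.sum_eq_single (i - k)]
  · simp [ket_apply]; ring
  · intro j _ hj
    have : i ≠ j + k := fun h => hj (by rw [h, add_sub_cancel_right])
    simp [ket_apply, this]
  · simp

/-- The vectors whose projectors form the Weyl-covariant POVM. -/
def weylVector (ν : Qudit d) (b : Fin d × Fin d) : Qudit d :=
  ((Real.sqrt d : ℝ) : ℂ)⁻¹ • U b.1 b.2 ν

omit [NeZero d] in
lemma sqrt_inv_mul_self : ((Real.sqrt d : ℝ) : ℂ)⁻¹ * ((Real.sqrt d : ℝ) : ℂ)⁻¹ = 1 / d := by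
  rw [← mul_inv, ← Complex.ofReal_mul, Real.mul_self_sqrt (Nat.cast_nonneg d), one_div]
  simp

omit [NeZero d] in
lemma weylPOVM_eq (ν : Qudit d) :
    weylPOVM ν = fun b => ketbra (weylVector ν b) (weylVector ν b) := by
  funext b
  ext1 x
  rw [weylPOVM, weylVector, LinearMap.smul_apply, LinearMap.comp_apply, LinearMap.comp_apply,
    ketbra_apply, ketbra_apply, map_smul, LinearMap.adjoint_inner_right, inner_smul_left, map_inv₀,
    Complex.conj_ofReal, smul_smul, smul_smul, ← sqrt_inv_mul_self]
  congr 1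
  ring

lemma inner_weylPOVM (ν : Qudit d) (k l i j : Fin d) :
    ⟪ket i, weylPOVM ν (k, l) (ket j)⟫_ℂ = (1 / d) *
      (omega d ^ ((l : ℕ) * (i - k : Fin d)) * conj (omega d) ^ ((l : ℕ) * (j - k : Fin d)) *
        (ν (i - k) * conj (ν (j - k)))) := by
  rw [weylPOVM, LinearMap.smul_apply, LinearMap.comp_apply, LinearMap.comp_apply,
    ketbra_apply, map_smul, LinearMap.adjoint_inner_right, inner_smul_right, inner_smul_right,
    inner_ket, ← inner_conj_symm, inner_ket, U_apply, U_apply, map_mul, map_pow]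
  ring

omit [NeZero d] in
lemma sum_mul_conj_eq_one {ν : Qudit d} (hν : ‖ν‖ = 1) : ∑ i, ν i * conj (ν i) = 1 := by
  have := EuclideanSpace.norm_sq_eq ν
  rw [hν] at this
  simp only [Complex.mul_conj, Complex.normSq_eq_norm_sq]
  rw [← Complex.ofReal_sum, ← this]
  simp

/-- The sum over l removes the off-diagonal entries, and the sum over k turns each diagonal entry
into ‖ν‖² = 1. -/
lemma isPOVM_weyl {ν : Qudit d} (hν : ‖ν‖ = 1) : IsPOVM (weylPOVM ν) := by
  refine ⟨fun b => by rw [weylPOVM_eq]; exact isPositive_ketbra _, ext_inner_ket fun i j => ?_⟩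
  have hd : (d : ℂ) ≠ 0 := Nat.cast_ne_zero.2 (NeZero.ne d)
  rw [LinearMap.sum_apply, inner_sum, Fintype.sum_prod_type]
  simp only [inner_weylPOVM, ← Finset.mul_sum, ← Finset.sum_mul, sum_omega_pow_mul_conj_pow,
    sub_left_inj, Module.End.one_apply]
  rw [inner_ket, ket_apply]
  split_ifs with h
  · subst h
    have h1 : ∑ k, ν (i - k) * conj (ν (i - k)) = 1 := by
      rw [← sum_mul_conj_eq_one hν]
      exact Equiv.sum_comp (Equiv.subLeft i) fun j => ν j * conj (ν j)
    rw [h1, mul_one, one_div_mul_cancel hd]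
  · simp

lemma expect_adjoint_U (ν : Qudit d) (k l : Fin d) :
    expect ν (LinearMap.adjoint (U k l))
      = ∑ m : Fin d, conj (omega d) ^ ((l : ℕ) * m) * (ν (m + k) * conj (ν m)) := by
  rw [expect, LinearMap.adjoint_inner_right, PiLp.inner_apply]
  calc _ = ∑ i, ν i * conj (U k l ν i) := rfl
    _ = ∑ m, ν (m + k) * conj (U k l ν (m + k)) :=
      (Equiv.sum_comp (Equiv.addRight k) fun i => ν i * conj (U k l ν i)).symm
    _ = _ := Finset.sum_congr rfl fun m _ => by
      rw [U_apply, add_sub_cancel_right, map_mul, map_pow]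
      ring

lemma weyl_linearIndependent {ν : Qudit d} (hν : IsWeylFiducial ν) (c : Fin d × Fin d → ℂ)
    (hc : ∑ b, c b • weylPOVM ν b = 0) (b : Fin d × Fin d) : c b = 0 := by
  have hd : (d : ℂ) ≠ 0 := Nat.cast_ne_zero.2 (NeZero.ne d)
  have hphase : ∀ l j a : Fin d, omega d ^ ((l : ℕ) * (j + a : Fin d)) *
      conj (omega d) ^ ((l : ℕ) * j) = omega d ^ ((l : ℕ) * a) := fun l j a => by
    rw [omega_pow_mul_add_val]
    linear_combination omega d ^ ((l : ℕ) * a) * omega_pow_mul_conj_pow (d := d) ((l : ℕ) * j)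
  -- In the entry (j + a, j) the sum over l is a Fourier transform of c, and the sum over k is a
  -- convolution with m ↦ ν(m+a) conj ν(m).
  have h1 : ∀ a j : Fin d, ∑ k, (∑ l : Fin d, omega d ^ ((a : ℕ) * l) * c (k, l)) *
      (ν (j - k + a) * conj (ν (j - k))) = 0 := fun a j => by
    have := congrArg (fun T : Qudit d →ₗ[ℂ] Qudit d => ⟪ket (j + a), T (ket j)⟫_ℂ) hc
    simp only [LinearMap.sum_apply, LinearMap.smul_apply, inner_sum, inner_smul_right,
      Fintype.sum_prod_type, inner_weylPOVM, add_sub_right_comm, hphase, LinearMap.zero_apply,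
      inner_zero_right] at this
    have h2 : ∑ k, ∑ l : Fin d, (1 / d : ℂ) * (omega d ^ ((a : ℕ) * l) * c (k, l) *
        (ν (j - k + a) * conj (ν (j - k)))) = 0 := by
      rw [← this]
      refine Finset.sum_congr rfl fun k _ => Finset.sum_congr rfl fun l _ => ?_
      rw [mul_comm (a : ℕ)]
      ring
    simp only [← Finset.mul_sum, ← Finset.sum_mul] at h2
    exact (mul_eq_zero.1 h2).resolve_left (one_div_ne_zero hd)
  -- A second Fourier transform, in j, turns the convolution into a product whose other factor is
  -- ⟨ν|U†|ν⟩ at (a, -b), nonzero by hypothesis.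
  have h2 : ∀ a b : Fin d, ∑ k : Fin d, omega d ^ ((b : ℕ) * k) *
      (∑ l : Fin d, omega d ^ ((a : ℕ) * l) * c (k, l)) = 0 := fun a b => by
    have hne := hν.2 a (-b)
    rw [expect_adjoint_U] at hne
    refine (mul_eq_zero.1 ?_).resolve_right hne
    have h3 : ∀ k : Fin d, omega d ^ ((b : ℕ) * k) * ∑ m : Fin d,
        conj (omega d) ^ (((-b : Fin d) : ℕ) * m) * (ν (m + a) * conj (ν m))
        = ∑ j : Fin d, omega d ^ ((b : ℕ) * j) * (ν (j - k + a) * conj (ν (j - k))) := fun k => by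
      rw [Finset.mul_sum, ← Equiv.sum_comp (Equiv.addRight k) fun j : Fin d =>
        omega d ^ ((b : ℕ) * j) * (ν (j - k + a) * conj (ν (j - k)))]
      refine Finset.sum_congr rfl fun m _ => ?_
      simp only [Equiv.coe_addRight, add_sub_cancel_right, omega_pow_mul_add_val,
        pow_mul (conj (omega d)), conj_omega_pow_neg_val]
      rw [← pow_mul]
      ring
    rw [Finset.sum_mul]
    calc _ = ∑ k, (∑ l : Fin d, omega d ^ ((a : ℕ) * l) * c (k, l)) *
          ∑ j : Fin d, omega d ^ ((b : ℕ) * j) * (ν (j - k + a) * conj (ν (j - k))) :=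
          Finset.sum_congr rfl fun k _ => by rw [← h3]; ring
      _ = ∑ k, ∑ j : Fin d, omega d ^ ((b : ℕ) * j) *
          ((∑ l : Fin d, omega d ^ ((a : ℕ) * l) * c (k, l)) *
            (ν (j - k + a) * conj (ν (j - k)))) :=
          Finset.sum_congr rfl fun k _ => by
            rw [Finset.mul_sum]
            exact Finset.sum_congr rfl fun j _ => by ring
      _ = 0 := by
          rw [Finset.sum_comm]
          exact Finset.sum_eq_zero fun j _ => by rw [← Finset.mul_sum, h1, mul_zero]
  have h3 : ∀ a k : Fin d, ∑ l : Fin d, omega d ^ ((a : ℕ) * l) * c (k, l) = 0 := fun a k =>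
    eq_zero_of_fourier_eq_zero (h2 a) k
  exact eq_zero_of_fourier_eq_zero (fun a => h3 a b.1) b.2

lemma isExtremalPOVM_weyl {ν : Qudit d} (hν : IsWeylFiducial ν) : IsExtremalPOVM (weylPOVM ν) := by
  have h1 := isPOVM_weyl hν.1
  have h2 := weyl_linearIndependent hν
  rw [weylPOVM_eq] at h1 h2 ⊢
  exact isExtremalPOVM_of_rankOne h1 h2

omit [NeZero d] in
lemma maxEntangled_sq (i : Fin d) : maxEntangled d i ^ 2 = 1 / d := by
  rw [maxEntangled, div_pow, one_pow, Real.sq_sqrt (Nat.cast_nonneg d)]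

lemma trace_weylPOVM {ν : Qudit d} (hν : ‖ν‖ = 1) (b : Fin d × Fin d) :
    LinearMap.trace ℂ (Qudit d) (weylPOVM ν b ∘ₗ reducedState (idealState (maxEntangled d)))
      = 1 / (d : ℂ) ^ 2 := by
  have h : ∀ i, ((maxEntangled d i ^ 2 : ℝ) : ℂ) * ⟪ket i, weylPOVM ν b (ket i)⟫_ℂ
      = (1 / d : ℂ) ^ 2 * (ν (i - b.1) * conj (ν (i - b.1))) := fun i => by
    rw [maxEntangled_sq, inner_weylPOVM, omega_pow_mul_conj_pow]
    push_cast; ring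
  rw [trace_comp_reducedState, Finset.sum_congr rfl fun i _ => h i, ← Finset.mul_sum]
  have h2 : ∑ i, ν (i - b.1) * conj (ν (i - b.1)) = 1 := by
    rw [← sum_mul_conj_eq_one hν]
    exact Equiv.sum_comp (Equiv.subRight b.1) fun j => ν j * conj (ν j)
  rw [h2]
  ring

end Weyl

/-! ### Existence of a fiducial vector -/

section Fiducial

variable {d : ℕ} [NeZero d]

/-- The vector with components `s^i`. -/
def geometricVector (d : ℕ) (s : ℂ) : Qudit d := WithLp.toLp 2 fun i => s ^ (i : ℕ)

omit [NeZero d] in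
/-- The autocorrelation of a geometric sequence over `ℤ/d`, as a pair of geometric sums. -/
lemma mul_sum_geometric (s y : ℂ) {k : ℕ} (hk : k < d) :
    (y * s - 1) * ∑ m ∈ Finset.range d, s ^ ((m + k) % d) * y ^ m
      = y ^ (d - k) * (s ^ d - 1) + s ^ k * (y ^ d - 1) := by
  -- n = d - k is the index from which m + k wraps around; on either side the sum is geometric with
  -- ratio ys.
  obtain ⟨n, hn⟩ : ∃ n, d = n + k := ⟨d - k, by omega⟩
  have e1 : ∑ m ∈ Finset.range n, s ^ ((m + k) % d) * y ^ m
      = s ^ k * ∑ m ∈ Finset.range n, (y * s) ^ m := by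
    rw [Finset.mul_sum]
    refine Finset.sum_congr rfl fun m hm => ?_
    have := Finset.mem_range.1 hm
    rw [Nat.mod_eq_of_lt (by omega)]
    ring
  have e2 : ∑ m ∈ Finset.range k, s ^ ((n + m + k) % d) * y ^ (n + m)
      = y ^ n * ∑ m ∈ Finset.range k, (y * s) ^ m := by
    rw [Finset.mul_sum]
    refine Finset.sum_congr rfl fun m hm => ?_
    have := Finset.mem_range.1 hm
    rw [show n + m + k = m + d by omega, Nat.add_mod_right, Nat.mod_eq_of_lt (by omega)]
    ring
  have h1 := geom_sum_mul (y * s) n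
  have h2 := geom_sum_mul (y * s) k
  rw [show Finset.range d = Finset.range (n + k) by rw [hn], Finset.sum_range_add, e1, e2,
    show d - k = n by omega, hn]
  simp only [mul_pow, pow_add] at h1 h2 ⊢
  linear_combination s ^ k * h1 + y ^ n * h2

lemma expect_geometricVector (s : ℂ) (k l : Fin d) :
    expect (geometricVector d s) (LinearMap.adjoint (U k l))
      = ∑ m ∈ Finset.range d, s ^ ((m + k) % d) * (conj (omega d) ^ (l : ℕ) * conj s) ^ m := by
  rw [expect_adjoint_U, ← Fin.sum_univ_eq_sum_range
    fun m => s ^ ((m + k) % d) * (conj (omega d) ^ (l : ℕ) * conj s) ^ m]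
  refine Finset.sum_congr rfl fun m _ => ?_
  simp only [geometricVector, Fin.val_add, map_pow]
  ring

/-- If the closed form vanished, comparing absolute values would give 2^(d-k) = 2^k, hence d = 2k.
The factor i in s^d excludes this case: it makes y^d the negative of s^d, and squaring then forces
(2^d)² = 1. -/
lemma expect_geometricVector_ne_zero (hd : 2 ≤ d) {s : ℂ} (hs : s ^ d = 2 ^ d * Complex.I)
    (k l : Fin d) : expect (geometricVector d s) (LinearMap.adjoint (U k l)) ≠ 0 := by
  intro h
  rw [expect_geometricVector] at h
  set y := conj (omega d) ^ (l : ℕ) * conj s with hy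
  have h1 := mul_sum_geometric s y k.2
  rw [h, mul_zero] at h1
  have hns : ‖s‖ = 2 := by
    have := congrArg norm hs
    rw [norm_pow, norm_mul, norm_pow, Complex.norm_I, mul_one] at this
    exact (pow_left_inj₀ (norm_nonneg _) (by norm_num) (by omega : d ≠ 0)).1 (by simpa using this)
  have hny : ‖y‖ = 2 := by
    rw [hy, norm_mul, norm_pow, RCLike.norm_conj, RCLike.norm_conj, norm_omega, hns]
    simp
  have hconj : conj (2 : ℂ) = 2 := Complex.conj_ofNat 2
  have hyd : y ^ d = - (2 ^ d * Complex.I) := by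
    rw [hy, mul_pow, ← pow_mul, mul_comm (l : ℕ), pow_mul, conj_omega_pow_self, one_pow, one_mul,
      ← map_pow, hs]
    simp [hconj]
  have hg : ‖s ^ d - 1‖ = ‖y ^ d - 1‖ := by
    rw [← RCLike.norm_conj, hs, hyd]
    congr 1
    simp [hconj]
  have ht : (1 : ℝ) < 2 ^ d := one_lt_pow₀ (by norm_num) (by omega)
  have hg0 : ‖s ^ d - 1‖ ≠ 0 := by
    rw [norm_ne_zero_iff, sub_ne_zero, hs]
    intro h2
    have := congrArg Complex.re h2
    rw [← Complex.ofReal_ofNat, ← Complex.ofReal_pow, Complex.re_ofReal_mul] at this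
    simp at this
  have h2 : y ^ (d - k) * (s ^ d - 1) = -(s ^ (k : ℕ) * (y ^ d - 1)) :=
    eq_neg_of_add_eq_zero_left h1.symm
  have h3 : (d : ℕ) - k = k := by
    have := congrArg norm h2
    rw [norm_neg, norm_mul, norm_mul, norm_pow, norm_pow, hny, hns, ← hg] at this
    exact Nat.pow_right_injective le_rfl (by exact_mod_cast mul_right_cancel₀ hg0 this)
  rw [h3] at h2
  have h4 : y ^ d * (s ^ d - 1) ^ 2 = s ^ d * (y ^ d - 1) ^ 2 := by
    have e : d = (k : ℕ) * 2 := by omega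
    have h5 := congrArg (· ^ 2) h2
    simp only [neg_sq, mul_pow, ← pow_mul, ← e] at h5
    exact h5
  rw [hyd, hs] at h4
  have h5 : (2 ^ d * Complex.I) * (((2 : ℂ) ^ d) ^ 2 - 1) = 0 := by
    linear_combination (1 / 2) * h4 + (2 ^ d * Complex.I * (2 ^ d) ^ 2) * Complex.I_sq
  have h6 : ((2 : ℂ) ^ d) ^ 2 - 1 = 0 :=
    (mul_eq_zero.1 h5).resolve_left (mul_ne_zero (pow_ne_zero _ two_ne_zero) Complex.I_ne_zero)
  have h7 : ((2 : ℝ) ^ d) ^ 2 - 1 = 0 := by exact_mod_cast h6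
  nlinarith

lemma exists_isWeylFiducial (hd : 2 ≤ d) : ∃ ν : Qudit d, IsWeylFiducial ν := by
  obtain ⟨s, hs⟩ := IsAlgClosed.exists_pow_nat_eq ((2 : ℂ) ^ d * Complex.I) (by omega : 0 < d)
  have hne := expect_geometricVector_ne_zero hd hs
  set v := geometricVector d s
  -- The vector is not normalised, but the fiducial condition is unaffected by nonzero rescaling.
  have hv : v ≠ 0 := fun h => hne 0 0 (by rw [h]; simp [expect])
  refine ⟨((‖v‖⁻¹ : ℝ) : ℂ) • v, ?_, fun k l => ?_⟩
  · rw [norm_smul, Complex.norm_real, norm_inv, norm_norm, inv_mul_cancel₀ (norm_ne_zero_iff.2 hv)]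
  · have h0 : ((‖v‖⁻¹ : ℝ) : ℂ) ≠ 0 :=
      Complex.ofReal_ne_zero.2 (inv_ne_zero (norm_ne_zero_iff.2 hv))
    rw [expect, map_smul, inner_smul_left, inner_smul_right, Complex.conj_ofReal]
    exact mul_ne_zero h0 (mul_ne_zero h0 (hne k l))

end Fiducial

end Steering

end

/-! ### The three claims together -/

theorem mainTheorem5 (d : ℕ) (hd : 2 ≤ d) :
    -- an arbitrary extremal POVM with `d²` outcomes and an arbitrary target state
    (∀ (O : Type*) [Fintype O] (α : Fin d → ℝ) (I : O → Steering.Qudit d →ₗ[ℂ] Steering.Qudit d),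
      Fintype.card O = d ^ 2 →
      (∀ i, 0 < α i) → ∑ i, α i ^ 2 = 1 →
      Steering.IsExtremalPOVM I →
      (∀ b, LinearMap.trace ℂ (Steering.Qudit d)
        (I b ∘ₗ Steering.reducedState (Steering.idealState α)) = 1 / (d : ℂ) ^ 2) →
      IsLUB (Steering.guessValues α I) (1 / (d : ℝ) ^ 2) ∧
      Steering.guessingProbability α I = 1 / (d : ℝ) ^ 2 ∧
      Steering.certifiedBits α I = 2 * Real.logb 2 d) ∧
    -- the maximally entangled state and the Weyl-covariant POVM
    (∀ ν : Steering.Qudit d, Steering.IsWeylFiducial ν →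
      Steering.IsExtremalPOVM (Steering.weylPOVM ν) ∧
      (∀ b, LinearMap.trace ℂ (Steering.Qudit d)
        (Steering.weylPOVM ν b ∘ₗ
          Steering.reducedState (Steering.idealState (Steering.maxEntangled d)))
            = 1 / (d : ℂ) ^ 2) ∧
      IsLUB (Steering.guessValues (Steering.maxEntangled d) (Steering.weylPOVM ν))
        (1 / (d : ℝ) ^ 2) ∧
      Steering.guessingProbability (Steering.maxEntangled d) (Steering.weylPOVM ν)
        = 1 / (d : ℝ) ^ 2 ∧
      Steering.certifiedBits (Steering.maxEntangled d) (Steering.weylPOVM ν)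
        = 2 * Real.logb 2 d) ∧
    (∃ ν : Steering.Qudit d, Steering.IsWeylFiducial ν) := by
  have : NeZero d := ⟨by omega⟩
  refine ⟨fun O _ α I hO hα hα1 hI htr =>
      Steering.certified_randomness hd hα hα1 hO hI htr, fun ν hν => ?_,
    Steering.exists_isWeylFiducial hd⟩
  have hI := Steering.isExtremalPOVM_weyl hν
  have htr := Steering.trace_weylPOVM hν.1
  refine ⟨hI, htr, Steering.certified_randomness hd (fun i => ?_) ?_ ?_ hI htr⟩
  · exact one_div_pos.2 (Real.sqrt_pos.2 (by exact_mod_cast (by omega : 0 < d)))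
  · simp only [Steering.maxEntangled_sq, Finset.sum_const, Finset.card_univ, Fintype.card_fin,
      nsmul_eq_mul]
    exact mul_one_div_cancel (by exact_mod_cast (by omega : d ≠ 0))
  · simp [sq]
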